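/- Let $(M,I,J,K,g)$ be a hyperkähler manifold: $M$ is a smooth manifold, $g$ is a Riemannian metric on $M$, and $I,J,K$ are complex structures on $M$ with $I\circ J=-J\circ I=K$, each of which makes $g$ Kähler. Let $\omega_I=g(I\cdot,\cdot)$, $\omega_J=g(J\cdot,\cdot)$, $\omega_K=g(K\cdot,\cdot)$ be the Kähler forms. For an integer $p\ge 0$ consider the $4p$-forms $$\Theta_p=\frac{(\omega_I^2+\omega_J^2+\omega_K^2)^p}{c_p},\qquad c_p=\sum_{k=0}^{p}\frac{(p!)^2}{(k!)^2}\,(2k)!\,4^{p-k},\qquad \Xi_p=\frac{(\omega_J^2+\omega_K^2)^p}{(p!)^2\,4^p}.$$ The comass of a $k$-form $\eta$ at a point $x\in M$ is the maximum of $\eta(v_1,\dots,v_k)/(|v_1|\cdots|v_k|)$ over all $k$-tuples of nonzero vectors in $T_xM$ (and $0$ if there are none). A calibration is a closed differential form whose comass is at most $1$ at every point. A face of a $k$-form $\eta$ at $x$ is a $k$-dimensional subspace $W\subset T_xM$ such that $\eta|_W$ equals the comass of $\eta$ at $x$ times one of the two unit volume forms of $W$. Then $\Theta_p$ is a calibration,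 and its faces are exactly the quaternionic subspaces of the tangent spaces $T_xM$ of quaternionic dimension $p$, that is, the real $4p$-dimensional subspaces invariant under $I$, $J$ and $K$. Moreover, $\Xi_p$ is also a calibration, with the same faces. Both forms are normalized: if $4p\le\dim_{\mathbb R}M$, they have comass exactly $1$ at every point. -/

import Mathlib

open scoped Manifold ContDiff

noncomputable section

namespace Calibration

/-! ### Linear algebra: wedge products, comass, faces -/

section Linear

variable {V : Type*} [AddCommGroup V] [Module ℝ V] [TopologicalSpace V]

/-- The wedge product of two alternating forms,
`(α ∧ β)(v₁, …, v_{a+b}) = ∑_σ sign(σ) α(v_{σ(1)}, …, v_{σ(a)}) β(v_{σ(a+1)}, …, v_{σ(a+b)})`,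
the sum being over the `(a, b)`-shuffles `σ`. -/
def wedgeAlt {a b : ℕ} (α : V [⋀^Fin a]→ₗ[ℝ] ℝ) (β : V [⋀^Fin b]→ₗ[ℝ] ℝ) :
    V [⋀^Fin (a + b)]→ₗ[ℝ] ℝ :=
  ((LinearMap.mul' ℝ ℝ).compAlternatingMap (α.domCoprod β)).domDomCongr finSumFinEquiv

theorem continuous_wedgeAlt {a b : ℕ} (α : V [⋀^Fin a]→L[ℝ] ℝ) (β : V [⋀^Fin b]→L[ℝ] ℝ) :
    Continuous fun v : Fin (a + b) → V => wedgeAlt α.toAlternatingMap β.toAlternatingMap v := by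
  have h : ∀ v : Fin (a + b) → V, wedgeAlt α.toAlternatingMap β.toAlternatingMap v
      = ∑ σ : Equiv.Perm.ModSumCongr (Fin a) (Fin b), LinearMap.mul' ℝ ℝ
          (AlternatingMap.domCoprod.summand α.toAlternatingMap β.toAlternatingMap σ
            (fun i => v (finSumFinEquiv i))) := by
    intro v
    simp only [wedgeAlt, AlternatingMap.domDomCongr_apply,
      LinearMap.compAlternatingMap_apply, AlternatingMap.domCoprod_apply,
      sum_apply, map_sum]
    rfl
  simp only [h]
  refine continuous_finsetSum _ fun σ _ => ?_
  induction σ using Quotient.inductionOn' with | _ σ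
  rw [AlternatingMap.domCoprod.summand_mk'']
  have h2 : ∀ v : Fin (a + b) → V, LinearMap.mul' ℝ ℝ
      ((Equiv.Perm.sign σ • (MultilinearMap.domCoprod (α.toAlternatingMap : MultilinearMap ℝ _ ℝ)
        (β.toAlternatingMap : MultilinearMap ℝ _ ℝ)).domDomCongr σ)
          (fun i => v (finSumFinEquiv i)))
      = Equiv.Perm.sign σ • (α (fun i => v (finSumFinEquiv (σ (Sum.inl i))))
          * β (fun i => v (finSumFinEquiv (σ (Sum.inr i))))) := by
    intro v
    rcases Int.units_eq_one_or (Equiv.Perm.sign σ) with h | h <;> rw [h] <;> simp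
  simp only [h2]
  have c1 : Continuous fun v : Fin (a + b) → V =>
      α (fun i => v (finSumFinEquiv (σ (Sum.inl i)))) :=
    α.cont.comp (continuous_pi fun i => continuous_apply _)
  have c2 : Continuous fun v : Fin (a + b) → V =>
      β (fun i => v (finSumFinEquiv (σ (Sum.inr i)))) :=
    β.cont.comp (continuous_pi fun i => continuous_apply _)
  exact (c1.mul c2).const_smul _

/-- The wedge product of continuous alternating forms. -/
def wedge {a b : ℕ} (α : V [⋀^Fin a]→L[ℝ] ℝ) (β : V [⋀^Fin b]→L[ℝ] ℝ) :
    V [⋀^Fin (a + b)]→L[ℝ] ℝ :=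
  { wedgeAlt α.toAlternatingMap β.toAlternatingMap with
    cont := continuous_wedgeAlt α β }

/-- The `p`-th wedge power of an `a`-form, an `(a * p)`-form. -/
def wedgePow {a : ℕ} (α : V [⋀^Fin a]→L[ℝ] ℝ) : (p : ℕ) → V [⋀^Fin (a * p)]→L[ℝ] ℝ
  | 0 =>
    haveI : IsEmpty (Fin (a * 0)) := inferInstanceAs (IsEmpty (Fin 0))
    ContinuousAlternatingMap.constOfIsEmpty ℝ V (Fin (a * 0)) (1 : ℝ)
  | p + 1 => wedge (wedgePow α p) α

/-- The length of a vector with respect to an inner product `g`. -/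
def length (g : V →L[ℝ] V →L[ℝ] ℝ) (v : V) : ℝ := √(g v v)

/-- The comass of a `k`-form: the maximum of `η(v₁, …, v_k) / (|v₁| ⋯ |v_k|)` over all `k`-tuples
of nonzero vectors. -/
def comass (g : V →L[ℝ] V →L[ℝ] ℝ) {k : ℕ} (η : V [⋀^Fin k]→L[ℝ] ℝ) : ℝ :=
  sSup {r : ℝ | ∃ v : Fin k → V, (∀ i, v i ≠ 0) ∧ r = η v / ∏ i, length g (v i)}

/-- `W` is a face of the `k`-form `η`: it is a `k`-dimensional subspace with
`η|_W = comass(η) • Vol(W)` for one of the two volume forms `± Vol(W)`, i.e. `η` takes the value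
`comass(η)` on an orthonormal basis of `W`. -/
def IsFace (g : V →L[ℝ] V →L[ℝ] ℝ) {k : ℕ} (η : V [⋀^Fin k]→L[ℝ] ℝ) (W : Submodule ℝ V) : Prop :=
  ∃ e : Fin k → V, (∀ i j, g (e i) (e j) = if i = j then 1 else 0) ∧
    Submodule.span ℝ (Set.range e) = W ∧ η e = comass g η

end Linear

/-! ### Differential forms on a manifold -/

section Manifold

variable (E : Type*) [NormedAddCommGroup E] [NormedSpace ℝ E]
variable (M : Type*) [TopologicalSpace M] [ChartedSpace E M]

/-- A field of alternating `k`-forms on the tangent spaces of `M`. -/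
abbrev FormField (k : ℕ) : Type _ :=
  ∀ x : M, (TangentSpace 𝓘(ℝ, E) x) [⋀^Fin k]→L[ℝ] ℝ

variable {E M}

/-- The coordinate expression `(e⁻¹)^* η` of a field of forms in a chart `e`. -/
def FormField.inChart {k : ℕ} (η : FormField E M k) (e : OpenPartialHomeomorph M E) :
    E → E [⋀^Fin k]→L[ℝ] ℝ :=
  fun y => (η (e.symm y)).compContinuousLinearMap (mfderiv 𝓘(ℝ, E) 𝓘(ℝ, E) e.symm y)

/-- A closed differential form: its coordinate expressions are smooth, with zero exterior
derivative. -/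
def FormField.IsClosedForm {k : ℕ} (η : FormField E M k) : Prop :=
  ∀ e ∈ atlas E M, ContDiffOn ℝ ∞ (η.inChart e) e.target ∧
    ∀ y ∈ e.target, extDeriv (η.inChart e) y = 0

/-- The pointwise wedge product of fields of forms. -/
def FormField.wedge {a b : ℕ} (α : FormField E M a) (β : FormField E M b) :
    FormField E M (a + b) :=
  fun x => Calibration.wedge (α x) (β x)

/-- The pointwise wedge power of a field of forms. -/
def FormField.wedgePow {a : ℕ} (α : FormField E M a) (p : ℕ) : FormField E M (a * p) :=
  fun x => Calibration.wedgePow (α x) p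

/-- The square `α ∧ α` of a field of `2`-forms. -/
def FormField.square (α : FormField E M 2) : FormField E M 4 := α.wedge α

variable [IsManifold 𝓘(ℝ, E) ∞ M]

variable (E M) in
/-- A smooth Riemannian metric on `M`. -/
abbrev Metric : Type _ :=
  Bundle.ContMDiffRiemannianMetric 𝓘(ℝ, E) ∞ E (fun x : M => TangentSpace 𝓘(ℝ, E) x)

/-- A precalibration is a form whose comass is at most `1` at every point. -/
def IsPrecalibration (g : Metric E M) {k : ℕ} (η : FormField E M k) : Prop :=
  ∀ x : M, comass (g.inner x) (η x) ≤ 1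

/-- A calibration is a closed differential form which is a precalibration. -/
def IsCalibration (g : Metric E M) {k : ℕ} (η : FormField E M k) : Prop :=
  η.IsClosedForm ∧ IsPrecalibration g η

/-! ### Hyperkähler manifolds -/

variable (E M) in
/-- A smooth almost complex structure on `M`. -/
structure AlmostComplexStructure where
  toFun (x : M) : TangentSpace 𝓘(ℝ, E) x →L[ℝ] TangentSpace 𝓘(ℝ, E) x
  sq (x : M) (v : TangentSpace 𝓘(ℝ, E) x) : toFun x (toFun x v) = -v
  contMDiff : ContMDiff 𝓘(ℝ, E) (𝓘(ℝ, E).prod 𝓘(ℝ, E →L[ℝ] E)) ∞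
    (fun x => Bundle.TotalSpace.mk' (E →L[ℝ] E)
      (E := fun x : M => TangentSpace 𝓘(ℝ, E) x →L[ℝ] TangentSpace 𝓘(ℝ, E) x) x (toFun x))

/-- An almost complex structure is a complex structure if `M` is covered by smooth charts
with values in a complex vector space `(E, J₀)` whose differential is complex linear. -/
def AlmostComplexStructure.IsIntegrable (A : AlmostComplexStructure E M) : Prop :=
  ∀ x : M, ∃ e ∈ IsManifold.maximalAtlas 𝓘(ℝ, E) ∞ M, x ∈ e.source ∧
    ∃ J₀ : E →L[ℝ] E, (∀ w, J₀ (J₀ w) = -w) ∧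
      ∀ y ∈ e.source, ∀ v : TangentSpace 𝓘(ℝ, E) y,
        (mfderiv 𝓘(ℝ, E) 𝓘(ℝ, E) e y (A.toFun y v) : E) =
          J₀ (mfderiv 𝓘(ℝ, E) 𝓘(ℝ, E) e y v)

/-- The metric `g` is Hermitian with respect to `A`. -/
def IsHermitian (g : Metric E M) (A : AlmostComplexStructure E M) : Prop :=
  ∀ (x : M) (v w : TangentSpace 𝓘(ℝ, E) x),
    g.inner x (A.toFun x v) (A.toFun x w) = g.inner x v w

theorem IsHermitian.apply_self {g : Metric E M} {A : AlmostComplexStructure E M}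
    (h : IsHermitian g A) (x : M) (v : TangentSpace 𝓘(ℝ, E) x) :
    g.inner x (A.toFun x v) v = 0 := by
  have h1 := h x (A.toFun x v) v
  rw [A.sq] at h1
  simp only [map_neg, neg_apply] at h1
  have h2 := g.symm x v (A.toFun x v)
  linarith

/-- The fundamental `2`-form `ω_A(v, w) = g(A v, w)` of a Hermitian metric. -/
def fundamentalForm (g : Metric E M) (A : AlmostComplexStructure E M) (h : IsHermitian g A) :
    FormField E M 2 := fun x =>
  { toFun := fun v => g.inner x (A.toFun x (v 0)) (v 1)
    map_update_add' := by
      intro inst v i a b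
      rw [Subsingleton.elim inst inferInstance]
      fin_cases i <;> simp
    map_update_smul' := by
      intro inst v i c a
      rw [Subsingleton.elim inst inferInstance]
      fin_cases i <;> simp
    map_eq_zero_of_eq' := by
      intro v i j hv hij
      have h01 : v 0 = v 1 := by
        fin_cases i <;> fin_cases j <;> simp_all
      simp only [h01]
      exact h.apply_self x (v 1)
    cont := by
      have h1 : Continuous fun v : Fin 2 → TangentSpace 𝓘(ℝ, E) x => A.toFun x (v 0) :=
        (A.toFun x).continuous.comp (continuous_apply 0)
      have h2 : Continuous fun v : Fin 2 → TangentSpace 𝓘(ℝ, E) x => v 1 := continuous_apply 1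
      have h3 : Continuous fun q : E × E =>
          (show E →L[ℝ] E →L[ℝ] ℝ from g.inner x) q.1 q.2 :=
        (show E →L[ℝ] E →L[ℝ] ℝ from g.inner x).continuous₂
      exact h3.comp (h1.prodMk h2) }

/-- The metric `g` is Kähler with respect to `A`. -/
structure IsKahler (g : Metric E M) (A : AlmostComplexStructure E M) : Prop where
  integrable : A.IsIntegrable
  hermitian : IsHermitian g A
  closed : (fundamentalForm g A hermitian).IsClosedForm

variable (E M) in
/-- A hyperkähler structure `(I, J, K, g)` on `M`. -/
structure HyperkahlerStructure where
  g : Metric E M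
  I : AlmostComplexStructure E M
  J : AlmostComplexStructure E M
  K : AlmostComplexStructure E M
  I_J (x : M) (v : TangentSpace 𝓘(ℝ, E) x) : I.toFun x (J.toFun x v) = K.toFun x v
  J_I (x : M) (v : TangentSpace 𝓘(ℝ, E) x) : J.toFun x (I.toFun x v) = -K.toFun x v
  kahler_I : IsKahler g I
  kahler_J : IsKahler g J
  kahler_K : IsKahler g K

namespace HyperkahlerStructure

variable (S : HyperkahlerStructure E M)

def omegaI : FormField E M 2 := fundamentalForm S.g S.I S.kahler_I.hermitian

def omegaJ : FormField E M 2 := fundamentalForm S.g S.J S.kahler_J.hermitian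

def omegaK : FormField E M 2 := fundamentalForm S.g S.K S.kahler_K.hermitian

/-- The normalising constant `c_p = ∑_{k=0}^p (p!)² / (k!)² (2k)! 4^{p-k}`. -/
def c (p : ℕ) : ℝ :=
  ∑ k ∈ Finset.range (p + 1),
    (p.factorial : ℝ) ^ 2 / (k.factorial : ℝ) ^ 2 * ((2 * k).factorial : ℝ) * 4 ^ (p - k)

/-- The `4p`-form `Θ_p = (ω_I² + ω_J² + ω_K²)^p / c_p`. -/
def Θ (p : ℕ) : FormField E M (4 * p) :=
  (c p)⁻¹ • (S.omegaI.square + S.omegaJ.square + S.omegaK.square).wedgePow p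

/-- The `4p`-form `Ξ_p = (ω_J² + ω_K²)^p / ((p!)² 4^p)`. -/
def Ξ (p : ℕ) : FormField E M (4 * p) :=
  ((p.factorial : ℝ) ^ 2 * 4 ^ p)⁻¹ • (S.omegaJ.square + S.omegaK.square).wedgePow p

/-- `W ⊆ T_x M` is a quaternionic subspace of quaternionic dimension `p`. -/
def IsQuaternionicSubspace (p : ℕ) (x : M) (W : Submodule ℝ (TangentSpace 𝓘(ℝ, E) x)) : Prop :=
  (∀ v ∈ W, S.I.toFun x v ∈ W) ∧ (∀ v ∈ W, S.J.toFun x v ∈ W) ∧ (∀ v ∈ W, S.K.toFun x v ∈ W) ∧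
    Module.finrank ℝ W = 4 * p

end HyperkahlerStructure

end Manifold

end Calibration

end

/-! Averaging Wirtinger's inequality over the 2-sphere of complex structures gives the theorem. For
a unit vector u = (a, b, c) the operator A_u = aI + bJ + cK is an orthogonal complex structure with
2-form ω_u = aω_I + bω_J + cω_K. On orthonormal 4p-frames, |ω_u^{2p}| ≤ (2p)!, with equality exactly
when the span is A_u-invariant (`abs_pfaff_le`, `map_mem_span_of_abs_pfaff_eq`,
`abs_pfaff_eq_factorial`).

The mean of ω_u^{2p} over the sphere is (ω_I² + ω_J² + ω_K²)^p / (2p+1) (`integral_sphere`), and c_p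
equals (2p+1)! (`HyperkahlerStructure.c_eq`), so Θ_p is the mean of ω_u^{2p}/(2p)!. Likewise Ξ_p is
its mean over the circle a = 0 (`integral_circle`). Both are therefore bounded by 1. Equality in the
mean forces equality for every u on that circle, in particular for J and K, hence invariance under
J, K and I = JK. Conversely, on a quaternionic subspace every ω_u^{2p} equals ±(2p)!, and by
continuity in u the sign is the same for all u, so a suitable orientation attains the bound.

To compute with wedge powers, a form restricted to a frame e_1, …, e_n becomes an element of the
exterior algebra of ℝⁿ via `toExt`, which turns wedge into product. The 2-forms land in the center,
a commutative ring, where the averaging identities are polynomial identities composed with the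
linear functional `topCenter`. The same dictionary writes d as ∑ ε_i ∂_i and yields closedness of
wedge products of closed forms when the first factor has even degree. -/

namespace Calibration

/-! ### Alternating forms as elements of an exterior algebra -/

section ToExt

variable {V : Type*} [AddCommGroup V] [Module ℝ V]
variable {M : Type*} [AddCommGroup M] [Module ℝ M] {ι : Type*} [Fintype ι]

/-- The element `∑_F η(e_{F(1)}, …, e_{F(k)}) ε_{F(1)} ⋯ ε_{F(k)} / k!` of the exterior algebra. -/
noncomputable def toExt (e : ι → V) (ε : ι → M) {k : ℕ} (η : V [⋀^Fin k]→ₗ[ℝ] ℝ) :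
    ExteriorAlgebra ℝ M :=
  (k.factorial : ℝ)⁻¹ • ∑ F : Fin k → ι, η (e ∘ F) • ExteriorAlgebra.ιMulti ℝ k (ε ∘ F)

theorem toExt_add (e : ι → V) (ε : ι → M) {k : ℕ} (η η' : V [⋀^Fin k]→ₗ[ℝ] ℝ) :
    toExt e ε (η + η') = toExt e ε η + toExt e ε η' := by
  simp [toExt, add_smul, Finset.sum_add_distrib]

/-- The value of an alternating form of top degree. -/
theorem toExt_top {k : ℕ} (e : Fin k → V) (ε : Fin k → M) (η : V [⋀^Fin k]→ₗ[ℝ] ℝ) :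
    toExt e ε η = η e • ExteriorAlgebra.ιMulti ℝ k ε := by
  have h : ∑ F : Fin k → Fin k, η (e ∘ F) • ExteriorAlgebra.ιMulti ℝ k (ε ∘ F)
      = ∑ σ : Equiv.Perm (Fin k), η e • ExteriorAlgebra.ιMulti ℝ k ε := by
    have h1 : ∀ σ : Equiv.Perm (Fin k), η e • ExteriorAlgebra.ιMulti ℝ k ε
        = η (e ∘ σ) • ExteriorAlgebra.ιMulti ℝ k (ε ∘ σ) := by
      intro σ
      rw [AlternatingMap.map_perm, AlternatingMap.map_perm]
      rcases Int.units_eq_one_or (Equiv.Perm.sign σ) with h | h <;> simp [h]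
    rw [Finset.sum_congr rfl fun σ _ => h1 σ]
    symm
    refine Finset.sum_bij_ne_zero (fun σ _ _ => (σ : Fin k → Fin k))
      (fun _ _ _ => Finset.mem_univ _) (fun σ _ _ τ _ _ h => DFunLike.coe_injective h) (fun F _ hF => ?_) (fun _ _ _ => rfl)
    have hinj : Function.Injective F := by
      by_contra hn
      apply hF
      rw [ExteriorAlgebra.ιMulti_eq_zero_of_not_inj, smul_zero]
      exact fun h => hn (Function.Injective.of_comp h)
    exact ⟨Equiv.ofBijective F (Finite.injective_iff_bijective.mp hinj), Finset.mem_univ _, hF, rfl⟩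
  rw [toExt, h, Finset.sum_const, Finset.card_univ, Fintype.card_perm, Fintype.card_fin,
    ← Nat.cast_smul_eq_nsmul ℝ, inv_smul_smul₀ (by positivity)]

/-- Each shuffle class contains a! b! permutations contributing equally; clearing this factor
replaces the sum over cosets by one over all permutations, with no choice of representatives. -/
theorem factorial_mul_wedgeAlt_apply [TopologicalSpace V] {a b : ℕ} (α : V [⋀^Fin a]→ₗ[ℝ] ℝ)
    (β : V [⋀^Fin b]→ₗ[ℝ] ℝ) (v : Fin (a + b) → V) :
    (a.factorial * b.factorial : ℝ) * wedgeAlt α β v =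
      ∑ σ : Equiv.Perm (Fin a ⊕ Fin b), (Equiv.Perm.sign σ : ℝ) *
        (α (fun i => v (finSumFinEquiv (σ (Sum.inl i)))) *
          β (fun i => v (finSumFinEquiv (σ (Sum.inr i))))) := by
  have h := congrArg (fun ψ => LinearMap.mul' ℝ ℝ (ψ (fun i => v (finSumFinEquiv i))))
    (MultilinearMap.domCoprod_alternization_eq α β)
  simp only [MultilinearMap.alternatization_apply, Fintype.card_fin] at h
  have h2 : (a.factorial * b.factorial : ℝ) * wedgeAlt α β v
      = LinearMap.mul' ℝ ℝ (((a.factorial * b.factorial) • α.domCoprod β)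
        fun i => v (finSumFinEquiv i)) := by
    rw [AlternatingMap.smul_apply, map_nsmul, nsmul_eq_mul]
    push_cast
    rfl
  rw [h2, ← h, map_sum]
  refine Finset.sum_congr rfl fun σ _ => ?_
  rcases Int.units_eq_one_or (Equiv.Perm.sign σ) with h | h <;> rw [h] <;> simp

/-- Reindexing the multi-indices F by σ produces a second factor sign(σ) from the product of the
ε's. The two signs cancel, so all (a+b)! permutations contribute the same product of sums. -/
theorem toExt_wedgeAlt [TopologicalSpace V] (e : ι → V) (ε : ι → M) {a b : ℕ}
    (α : V [⋀^Fin a]→ₗ[ℝ] ℝ) (β : V [⋀^Fin b]→ₗ[ℝ] ℝ) :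
    toExt e ε (wedgeAlt α β) = toExt e ε α * toExt e ε β := by
  have key : (a.factorial * b.factorial : ℝ) •
      (∑ F : Fin (a + b) → ι, wedgeAlt α β (e ∘ F) • ExteriorAlgebra.ιMulti ℝ (a + b) (ε ∘ F)) =
      ((a + b).factorial : ℝ) •
        ((∑ F : Fin a → ι, α (e ∘ F) • ExteriorAlgebra.ιMulti ℝ a (ε ∘ F)) *
        (∑ F : Fin b → ι, β (e ∘ F) • ExteriorAlgebra.ιMulti ℝ b (ε ∘ F))) := by
    simp only [Finset.smul_sum, smul_smul, factorial_mul_wedgeAlt_apply, Finset.sum_smul]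
    rw [Finset.sum_comm]
    have h1 : ∀ σ : Equiv.Perm (Fin a ⊕ Fin b),
        ∑ F : Fin (a + b) → ι, ((Equiv.Perm.sign σ : ℝ) *
          (α (fun i => (e ∘ F) (finSumFinEquiv (σ (Sum.inl i)))) *
          β (fun i => (e ∘ F) (finSumFinEquiv (σ (Sum.inr i)))))) •
            ExteriorAlgebra.ιMulti ℝ (a + b) (ε ∘ F) =
        ((∑ F : Fin a → ι, α (e ∘ F) • ExteriorAlgebra.ιMulti ℝ a (ε ∘ F)) *
        (∑ F : Fin b → ι, β (e ∘ F) • ExteriorAlgebra.ιMulti ℝ b (ε ∘ F))) := by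
      intro σ
      set τ : Equiv.Perm (Fin (a + b)) := finSumFinEquiv.permCongr σ with hτ
      rw [Finset.sum_mul_sum, ← Finset.sum_product', Finset.univ_product_univ,
        ← (Fin.appendEquiv a b).symm.sum_comp, ← (τ.arrowCongr (Equiv.refl ι)).sum_comp]
      refine Finset.sum_congr rfl fun F _ => ?_
      have hs : ExteriorAlgebra.ιMulti ℝ (a + b) (ε ∘ (τ.arrowCongr (Equiv.refl ι)) F)
          = (Equiv.Perm.sign σ : ℝ) • ExteriorAlgebra.ιMulti ℝ (a + b) (ε ∘ F) := by
        have : ε ∘ (τ.arrowCongr (Equiv.refl ι)) F = (ε ∘ F) ∘ τ.symm := by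
          ext i; simp [Equiv.arrowCongr]
        rw [this, AlternatingMap.map_perm]
        have hsg : Equiv.Perm.sign τ.symm = Equiv.Perm.sign σ := by
          rw [Equiv.Perm.sign_symm, hτ, Equiv.Perm.sign_permCongr]
        rw [hsg]
        rcases Int.units_eq_one_or (Equiv.Perm.sign σ) with h | h <;> simp [h]
      have hF : ExteriorAlgebra.ιMulti ℝ (a + b) (ε ∘ F) =
          ExteriorAlgebra.ιMulti ℝ a (ε ∘ ((Fin.appendEquiv a b).symm F).1) *
          ExteriorAlgebra.ιMulti ℝ b (ε ∘ ((Fin.appendEquiv a b).symm F).2) := by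
        rw [ExteriorAlgebra.ιMulti_mul_ιMulti]
        congr 1
        ext i
        refine Fin.addCases (fun i => ?_) (fun i => ?_) i <;> simp [Fin.appendEquiv]
      rw [hs, hF, smul_mul_smul_comm, smul_smul]
      congr 1
      have hτs : ∀ s, τ.symm (finSumFinEquiv (σ s)) = finSumFinEquiv s := fun s => by
        rw [Equiv.symm_apply_eq, hτ, Equiv.permCongr_apply, Equiv.symm_apply_apply]
      have e1 : (fun i => (e ∘ (τ.arrowCongr (Equiv.refl ι)) F) (finSumFinEquiv (σ (Sum.inl i))))
          = e ∘ ((Fin.appendEquiv a b).symm F).1 := by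
        ext i; simp [Fin.appendEquiv, Equiv.arrowCongr, hτs]
      have e2 : (fun i => (e ∘ (τ.arrowCongr (Equiv.refl ι)) F) (finSumFinEquiv (σ (Sum.inr i))))
          = e ∘ ((Fin.appendEquiv a b).symm F).2 := by
        ext i; simp [Fin.appendEquiv, Equiv.arrowCongr, hτs]
      rw [e1, e2]
      rcases Int.units_eq_one_or (Equiv.Perm.sign σ) with h | h <;> simp [h]
    rw [Finset.sum_congr rfl fun σ _ => h1 σ, Finset.sum_const, Finset.card_univ,
      Fintype.card_perm, Fintype.card_sum, Fintype.card_fin, Fintype.card_fin,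
      Nat.cast_smul_eq_nsmul]
  rw [toExt, toExt, toExt, smul_mul_smul_comm, inv_smul_eq_iff₀ (by positivity), smul_comm,
    eq_comm, ← mul_inv, inv_smul_eq_iff₀ (by positivity), key]

theorem toExt_wedgePow [TopologicalSpace V] (e : ι → V) (ε : ι → M) {a : ℕ}
    (α : V [⋀^Fin a]→L[ℝ] ℝ) (p : ℕ) :
    toExt e ε (wedgePow α p).toAlternatingMap = toExt e ε α.toAlternatingMap ^ p := by
  induction p with
  | zero =>
    have : ∀ F : Fin (a * 0) → ι, (wedgePow α 0).toAlternatingMap (e ∘ F) •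
      ExteriorAlgebra.ιMulti ℝ (a * 0) (ε ∘ F) = 1 := by
      intro F
      rw [show (wedgePow α 0).toAlternatingMap (e ∘ F) = 1 from rfl, one_smul]
      exact ExteriorAlgebra.ιMulti_zero_apply _
    rw [toExt, Finset.sum_congr rfl fun F _ => this F]
    simp
  | succ p ih =>
    rw [pow_succ, ← ih]
    exact toExt_wedgeAlt e ε (wedgePow α p).toAlternatingMap α.toAlternatingMap

end ToExt

/-! ### Central elements and products of vectors in the exterior algebra -/

open ExteriorAlgebra in
theorem ι_mul_ι_mul_comm {M : Type*} [AddCommGroup M] [Module ℝ M] (a b c : M) :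
    ι ℝ a * ι ℝ b * ι ℝ c = ι ℝ c * (ι ℝ a * ι ℝ b) := by
  have h1 := eq_neg_of_add_eq_zero_left (ι_add_mul_swap (R := ℝ) b c)
  have h2 := eq_neg_of_add_eq_zero_left (ι_add_mul_swap (R := ℝ) a c)
  rw [mul_assoc, h1, mul_neg, ← mul_assoc, h2, neg_mul, neg_neg, mul_assoc]

theorem mem_center_of_forall_ι_comm {M : Type*} [AddCommGroup M] [Module ℝ M]
    {x : ExteriorAlgebra ℝ M} (h : ∀ m, x * ExteriorAlgebra.ι ℝ m = ExteriorAlgebra.ι ℝ m * x) :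
    x ∈ Subalgebra.center ℝ (ExteriorAlgebra ℝ M) := by
  rw [Subalgebra.mem_center_iff]
  intro y
  induction y using ExteriorAlgebra.induction with
  | algebraMap r => exact Algebra.commutes r x
  | ι m => exact (h m).symm
  | mul a b ha hb => rw [mul_assoc, hb, ← mul_assoc, ha, mul_assoc]
  | add a b ha hb => rw [add_mul, mul_add, ha, hb]

section IotaMulti

variable {M : Type*} [AddCommGroup M] [Module ℝ M] {k : ℕ}

theorem ι_mul_ιMulti (m : M) (v : Fin k → M) :
    ExteriorAlgebra.ι ℝ m * ExteriorAlgebra.ιMulti ℝ k v =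
      ExteriorAlgebra.ιMulti ℝ (k + 1) (Fin.cons m v) := by
  rw [ExteriorAlgebra.ιMulti_apply, ExteriorAlgebra.ιMulti_apply, List.ofFn_succ, List.prod_cons]
  simp only [Fin.cons_zero, Fin.cons_succ]

theorem ιMulti_mul_ι (m : M) (v : Fin k → M) :
    ExteriorAlgebra.ιMulti ℝ k v * ExteriorAlgebra.ι ℝ m =
      ExteriorAlgebra.ιMulti ℝ (k + 1) (Fin.snoc v m) := by
  rw [ExteriorAlgebra.ιMulti_apply, ExteriorAlgebra.ιMulti_apply, List.ofFn_succ',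
    List.prod_concat]
  simp only [Fin.snoc_castSucc, Fin.snoc_last]

theorem ι_mul_ιMulti_self (v : Fin k → M) (j : Fin k) :
    ExteriorAlgebra.ι ℝ (v j) * ExteriorAlgebra.ιMulti ℝ k v = 0 := by
  rw [ι_mul_ιMulti]
  exact AlternatingMap.map_eq_zero_of_eq _ _ (i := 0) (j := j.succ) (by simp)
    (Fin.succ_ne_zero j).symm

theorem ιMulti_mul_ι_self (v : Fin k → M) (j : Fin k) :
    ExteriorAlgebra.ιMulti ℝ k v * ExteriorAlgebra.ι ℝ (v j) = 0 := by
  rw [ιMulti_mul_ι]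
  exact AlternatingMap.map_eq_zero_of_eq _ _ (i := j.castSucc) (j := Fin.last k) (by simp)
    (Fin.castSucc_ne_last j)

end IotaMulti

/-- The binomial expansion stops after its linear term because n² = 0. It is applied with n a
product of two vectors split off from a bivector. -/
theorem add_pow_succ_of_mul_self_eq_zero {R : Type*} [Ring R] {z n : R} (h : Commute z n)
    (hn : n * n = 0) (m : ℕ) : (z + n) ^ (m + 1) = z ^ (m + 1) + (m + 1 : ℕ) • (z ^ m * n) := by
  induction m with
  | zero => simp
  | succ m ih =>
    have h1 : z ^ m * n * z = z ^ (m + 1) * n := by rw [mul_assoc, ← h.eq, ← mul_assoc, pow_succ]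
    have h2 : z ^ m * n * n = 0 := by rw [mul_assoc, hn, mul_zero]
    rw [pow_succ, ih, add_mul, mul_add, mul_add, smul_mul_assoc, smul_mul_assoc, h1, h2, smul_zero,
      add_zero, ← pow_succ, succ_nsmul (z ^ (m + 1) * n) (m + 1)]
    abel

/-! ### Bivectors and the exterior derivative in the exterior algebra -/

section ToExt

variable {V : Type*} [AddCommGroup V] [Module ℝ V]
variable {M : Type*} [AddCommGroup M] [Module ℝ M] {ι : Type*} [Fintype ι]

/-- The bivector `½ ∑ A_{ij} ε_i ε_j`. -/
noncomputable def bivector (ε : ι → M) (A : ι → ι → ℝ) : ExteriorAlgebra ℝ M :=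
  (2 : ℝ)⁻¹ • ∑ i, ∑ j, A i j • (ExteriorAlgebra.ι ℝ (ε i) * ExteriorAlgebra.ι ℝ (ε j))

theorem bivector_mem_center (ε : ι → M) (A : ι → ι → ℝ) :
    bivector ε A ∈ Subalgebra.center ℝ (ExteriorAlgebra ℝ M) :=
  Subalgebra.smul_mem _ (Subalgebra.sum_mem _ fun _ _ => Subalgebra.sum_mem _ fun _ _ =>
    Subalgebra.smul_mem _ (mem_center_of_forall_ι_comm fun _ => ι_mul_ι_mul_comm _ _ _) _) _

theorem toExt_two (e : ι → V) (ε : ι → M) (η : V [⋀^Fin 2]→ₗ[ℝ] ℝ) :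
    toExt e ε η = bivector ε fun i j => η ![e i, e j] := by
  rw [toExt, bivector, Nat.factorial_two, Nat.cast_ofNat]
  congr 1
  rw [← (finTwoArrowEquiv ι).symm.sum_comp, ← Finset.univ_product_univ, Finset.sum_product]
  refine Finset.sum_congr rfl fun i _ => Finset.sum_congr rfl fun j _ => ?_
  congr 1
  · congr 1
    ext k; fin_cases k <;> simp
  · simp [ExteriorAlgebra.ιMulti_apply]
    rfl

/-- Moving a vector past k vectors costs k signs. For even k there is none, which is what the
Leibniz rule for closed forms needs. -/
theorem toExt_mul_ι {k : ℕ} (e : ι → V) (ε : ι → M) (η : V [⋀^Fin k]→ₗ[ℝ] ℝ) (m : M) :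
    toExt e ε η * ExteriorAlgebra.ι ℝ m = (-1 : ℝ) ^ k • (ExteriorAlgebra.ι ℝ m * toExt e ε η) := by
  have h : ∀ (k : ℕ) (v : Fin k → M), ExteriorAlgebra.ιMulti ℝ k v * ExteriorAlgebra.ι ℝ m
      = (-1 : ℝ) ^ k • (ExteriorAlgebra.ι ℝ m * ExteriorAlgebra.ιMulti ℝ k v) := by
    intro k
    induction k with
    | zero => intro v; simp [ExteriorAlgebra.ιMulti_zero_apply]
    | succ k ih =>
      intro v
      have hs : ExteriorAlgebra.ιMulti ℝ (k + 1) v = ExteriorAlgebra.ι ℝ (v 0) *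
        ExteriorAlgebra.ιMulti ℝ k (Matrix.vecTail v) := ExteriorAlgebra.ιMulti_succ_apply v
      rw [hs, mul_assoc, ih, mul_smul_comm, ← mul_assoc, ← mul_assoc,
        eq_neg_of_add_eq_zero_left (ExteriorAlgebra.ι_add_mul_swap (R := ℝ) (v 0) m)]
      simp [pow_succ]
  simp only [toExt, smul_mul_assoc, mul_smul_comm, Finset.sum_mul, Finset.mul_sum, h,
    Finset.smul_sum]
  refine Finset.sum_congr rfl fun F _ => ?_
  simp only [smul_smul]
  congr 1
  ring

/-- This is the formula d = ∑ ε_i ∂_i. Moving the index in position a to the front cancels the sign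
(-1)^a, so the k+1 terms of the alternatization agree, and the factor k+1 is absorbed by the
factorials. -/
theorem toExt_alternatizeUncurryFin {k : ℕ} (e : ι → V) (ε : ι → M)
    (f : V →ₗ[ℝ] V [⋀^Fin k]→ₗ[ℝ] ℝ) :
    toExt e ε (AlternatingMap.alternatizeUncurryFin f) =
      ∑ i, ExteriorAlgebra.ι ℝ (ε i) * toExt e ε (f (e i)) := by
  have key : ∑ F : Fin (k + 1) → ι, AlternatingMap.alternatizeUncurryFin f (e ∘ F) •
      ExteriorAlgebra.ιMulti ℝ (k + 1) (ε ∘ F) = ((k + 1 : ℕ) : ℝ) • ∑ i, ∑ G : Fin k → ι,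
        f (e i) (e ∘ G) • (ExteriorAlgebra.ι ℝ (ε i) * ExteriorAlgebra.ιMulti ℝ k (ε ∘ G)) := by
    simp only [AlternatingMap.alternatizeUncurryFin_apply, Finset.sum_smul]
    rw [Finset.sum_comm]
    have h1 : ∀ a : Fin (k + 1), ∑ F : Fin (k + 1) → ι,
        ((-1) ^ (a : ℕ) • f ((e ∘ F) a) (a.removeNth (e ∘ F))) •
          ExteriorAlgebra.ιMulti ℝ (k + 1) (ε ∘ F) = ∑ i, ∑ G : Fin k → ι,
        f (e i) (e ∘ G) • (ExteriorAlgebra.ι ℝ (ε i) * ExteriorAlgebra.ιMulti ℝ k (ε ∘ G)) := by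
      intro a
      rw [← Finset.sum_product', Finset.univ_product_univ,
        ← (Fin.insertNthEquiv (fun _ => ι) a).sum_comp]
      refine Finset.sum_congr rfl fun x _ => ?_
      obtain ⟨i, G⟩ := x
      have h2 : ε ∘ (Fin.insertNthEquiv (fun _ => ι) a) (i, G) = a.insertNth (ε i) (ε ∘ G) := by
        ext j
        refine Fin.succAboveCases a ?_ (fun j => ?_) j <;> simp
      have h3 : a.removeNth (e ∘ (Fin.insertNthEquiv (fun _ => ι) a) (i, G)) = e ∘ G := by
        ext j; simp [Fin.removeNth]
      have h4 : (ExteriorAlgebra.ι ℝ (ε i) * ExteriorAlgebra.ιMulti ℝ k (ε ∘ G)) =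
          ExteriorAlgebra.ιMulti ℝ (k + 1) (Matrix.vecCons (ε i) (ε ∘ G)) := by
        rw [ExteriorAlgebra.ιMulti_succ_apply]; simp
      rw [h2, h3, h4, AlternatingMap.map_insertNth]
      simp only [Function.comp_apply, Fin.insertNthEquiv_apply, Fin.insertNth_apply_same]
      rcases Nat.even_or_odd a with h | h <;> simp [h.neg_one_pow]
    rw [Finset.sum_congr rfl fun a _ => h1 a, Finset.sum_const, Finset.card_univ,
      Fintype.card_fin, Nat.cast_smul_eq_nsmul]
  simp only [toExt, mul_smul_comm, Finset.mul_sum]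
  rw [key, smul_smul, ← Finset.smul_sum]
  congr 1
  rw [Nat.factorial_succ]
  push_cast
  field_simp

end ToExt

/-- The coefficient of `ε_1 ⋯ ε_n` of an element of the exterior algebra of `ℝⁿ`. -/
noncomputable def topCoeff (n : ℕ) : ExteriorAlgebra ℝ (Fin n → ℝ) →ₗ[ℝ] ℝ :=
  ExteriorAlgebra.liftAlternating fun i =>
    if h : n = i then (Pi.basisFun ℝ (Fin n)).det.domDomCongr (finCongr h) else 0

theorem topCoeff_ιMulti (n : ℕ) (v : Fin n → Fin n → ℝ) :
    topCoeff n (ExteriorAlgebra.ιMulti ℝ n v) = (Pi.basisFun ℝ (Fin n)).det v := by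
  simp [topCoeff, ExteriorAlgebra.liftAlternating_apply_ιMulti]

theorem topCoeff_basis (n : ℕ) :
    topCoeff n (ExteriorAlgebra.ιMulti ℝ n (Pi.basisFun ℝ (Fin n))) = 1 := by
  rw [topCoeff_ιMulti, Module.Basis.det_self]

theorem topCoeff_toExt {V : Type*} [AddCommGroup V] [Module ℝ V] {n : ℕ} (e : Fin n → V)
    (η : V [⋀^Fin n]→ₗ[ℝ] ℝ) : topCoeff n (toExt e (Pi.basisFun ℝ (Fin n)) η) = η e := by
  rw [toExt_top, map_smul, topCoeff_basis, smul_eq_mul, mul_one]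

/-! ### Reduction from arbitrary families to orthonormal ones -/

section Hadamard

variable {F : Type*} [NormedAddCommGroup F] [InnerProductSpace ℝ F]

/-- **Hadamard's inequality** for alternating forms of top degree. -/
theorem abs_apply_le_of_mem_span {n : ℕ} (η : F [⋀^Fin n]→ₗ[ℝ] ℝ) {e v : Fin n → F}
    (he : Orthonormal ℝ e) (hv : ∀ i, v i ∈ Submodule.span ℝ (Set.range e)) :
    |η v| ≤ |η e| * ∏ i, ‖v i‖ := by
  set W := Submodule.span ℝ (Set.range e) with hW
  have hb0 : ∀ i, ((Module.Basis.span he.linearIndependent i : W) : F) = e i :=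
    fun i => congrArg Subtype.val (Module.Basis.span_apply he.linearIndependent i)
  have hon : Orthonormal ℝ (Module.Basis.span he.linearIndependent) := by
    rw [← W.subtypeₗᵢ.orthonormal_comp_iff]
    convert he using 1
    ext i
    exact hb0 i
  let b : OrthonormalBasis (Fin n) ℝ W :=
    (Module.Basis.span he.linearIndependent).toOrthonormalBasis hon
  have hb : ∀ i, (b i : F) = e i := by
    intro i
    rw [← hb0 i]
    simp [b]
  let w : Fin n → W := fun i => ⟨v i, hv i⟩
  have : Fact (Module.finrank ℝ W = n) := ⟨by
    rw [Module.finrank_eq_card_basis b.toBasis, Fintype.card_fin]⟩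
  -- On the span, η is η(e) times the determinant in the orthonormal basis, which is the volume
  -- form; Hadamard's bound for the latter suffices.
  have h1 := b.toBasis.orientation.abs_volumeForm_apply_le w
  rw [Orientation.volumeForm_robust _ b rfl] at h1
  have h2 := AlternatingMap.eq_smul_basis_det b.toBasis (η.compLinearMap W.subtype)
  have h3 := DFunLike.congr_fun h2 w
  have h4 : (η.compLinearMap W.subtype) b.toBasis = η e := by
    rw [AlternatingMap.compLinearMap_apply]
    congr 1
    ext i
    simp [hb]
  rw [h4] at h3
  have h5 : (η.compLinearMap W.subtype) w = η v := rfl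
  rw [h5] at h3
  rw [h3, AlternatingMap.smul_apply, smul_eq_mul, abs_mul]
  exact mul_le_mul_of_nonneg_left h1 (abs_nonneg _)

/-- Hadamard's inequality in both directions, with all lengths equal to 1. Up to sign, a value thus
depends only on the subspace, and the basis may be adapted freely. -/
theorem abs_apply_eq_of_span_eq {n : ℕ} (η : F [⋀^Fin n]→ₗ[ℝ] ℝ) {e e' : Fin n → F}
    (he : Orthonormal ℝ e) (he' : Orthonormal ℝ e')
    (h : Submodule.span ℝ (Set.range e) = Submodule.span ℝ (Set.range e')) :
    |η e| = |η e'| := by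
  have key : ∀ {e e' : Fin n → F}, Orthonormal ℝ e → Orthonormal ℝ e' →
    Submodule.span ℝ (Set.range e) = Submodule.span ℝ (Set.range e') → |η e| ≤ |η e'| := by
    intro e e' he he' h
    have := abs_apply_le_of_mem_span η he' (v := e)
      fun i => h ▸ Submodule.subset_span (Set.mem_range_self i)
    simpa [he.1] using this
  exact le_antisymm (key he he' h) (key he' he h.symm)

theorem exists_orthonormal_span_eq {n : ℕ} (W : Submodule ℝ F) [FiniteDimensional ℝ W]
    (h : Module.finrank ℝ W = n) :
    ∃ e : Fin n → F, Orthonormal ℝ e ∧ Submodule.span ℝ (Set.range e) = W := by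
  let b := (stdOrthonormalBasis ℝ W).reindex (finCongr h)
  refine ⟨fun i => (b i : F), ?_, ?_⟩
  · exact W.subtypeₗᵢ.orthonormal_comp_iff.mpr b.orthonormal
  · have h1 : Set.range (fun i => (b i : F)) = W.subtype '' Set.range b := by
      rw [← Set.range_comp]; rfl
    rw [h1, ← Submodule.map_span]
    have h2 : Submodule.span ℝ (Set.range b) = ⊤ := by
      rw [← b.coe_toBasis]; exact b.toBasis.span_eq
    rw [h2, Submodule.map_subtype_top]

/-- A bound on orthonormal families gives a bound on all families. -/
theorem abs_apply_le_prod_norm {n : ℕ} (η : F [⋀^Fin n]→ₗ[ℝ] ℝ) {C : ℝ} (hC : 0 ≤ C)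
    (h : ∀ e : Fin n → F, Orthonormal ℝ e → |η e| ≤ C) (v : Fin n → F) :
    |η v| ≤ C * ∏ i, ‖v i‖ := by
  by_cases hv : LinearIndependent ℝ v
  · have := FiniteDimensional.span_of_finite ℝ (Set.finite_range v)
    obtain ⟨e, he, hs⟩ := exists_orthonormal_span_eq (n := n) (Submodule.span ℝ (Set.range v))
      (by rw [finrank_span_eq_card hv, Fintype.card_fin])
    refine (abs_apply_le_of_mem_span η he
      fun i => hs ▸ Submodule.subset_span (Set.mem_range_self i)).trans ?_
    exact mul_le_mul_of_nonneg_right (h e he) (Finset.prod_nonneg fun _ _ => norm_nonneg _)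
  · rw [AlternatingMap.map_linearDependent η v hv, abs_zero]
    exact mul_nonneg hC (Finset.prod_nonneg fun _ _ => norm_nonneg _)

end Hadamard

/-! ### Pfaffians: expansion along a sparse row -/

section Wirtinger

variable {F : Type*} [NormedAddCommGroup F] [InnerProductSpace ℝ F]

/-- The `2`-form `⟪A v, w⟫` of a skew-adjoint contraction. -/
noncomputable def skewForm (A : F →ₗ[ℝ] F) (hA : ∀ v, inner ℝ (A v) v = 0)
    (hn : ∀ v, ‖A v‖ ≤ ‖v‖) : F [⋀^Fin 2]→L[ℝ] ℝ :=
  AlternatingMap.mkContinuous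
    { toFun := fun v => inner ℝ (A (v 0)) (v 1)
      map_update_add' := by
        intro inst v i a b
        rw [Subsingleton.elim inst inferInstance]
        fin_cases i <;> simp [inner_add_left, inner_add_right]
      map_update_smul' := by
        intro inst v i c a
        rw [Subsingleton.elim inst inferInstance]
        fin_cases i <;> simp [inner_smul_left, inner_smul_right]
      map_eq_zero_of_eq' := by
        intro v i j hv hij
        have h01 : v 0 = v 1 := by
          fin_cases i <;> fin_cases j <;> simp_all
        simp only [h01]
        exact hA (v 1) } 1 (by
      intro v
      rw [one_mul, Fin.prod_univ_two]
      exact (norm_inner_le_norm _ _).trans (mul_le_mul_of_nonneg_right (hn _) (norm_nonneg _)))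

/-- The value of the `m`-th power of the `2`-form `⟪A v, w⟫` on a family of `n = 2m` vectors. -/
noncomputable def pfaff (A : F →ₗ[ℝ] F) (m : ℕ) {n : ℕ} (e : Fin n → F) : ℝ :=
  topCoeff n (bivector (Pi.basisFun ℝ (Fin n)) (fun i j => inner ℝ (A (e i)) (e j)) ^ m)

variable {A : F →ₗ[ℝ] F}

theorem bivector_pow_eq (hA : ∀ v, inner ℝ (A v) v = 0) (hn : ∀ v, ‖A v‖ ≤ ‖v‖)
    {M : Type*} [AddCommGroup M] [Module ℝ M] {ι : Type*} [Fintype ι] (e : ι → F) (ε : ι → M)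
    (m : ℕ) : bivector ε (fun i j => inner ℝ (A (e i)) (e j)) ^ m =
      toExt e ε (wedgePow (skewForm A hA hn) m).toAlternatingMap := by
  rw [toExt_wedgePow, toExt_two]
  rfl

/-- Links `pfaff`, which accepts families of any length and so avoids casts between 4p, k+2 and 2m,
to the wedge power, whose degree is literally `2 * m`. -/
theorem pfaff_eq (hA : ∀ v, inner ℝ (A v) v = 0) (hn : ∀ v, ‖A v‖ ≤ ‖v‖) (m : ℕ)
    (e : Fin (2 * m) → F) : pfaff A m e = wedgePow (skewForm A hA hn) m e := by
  rw [pfaff, bivector_pow_eq hA hn]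
  exact topCoeff_toExt _ _

theorem bivector_mul_ιMulti {M : Type*} [AddCommGroup M] [Module ℝ M] {k : ℕ} (ε : Fin k → M)
    (A : Fin k → Fin k → ℝ) : bivector ε A * ExteriorAlgebra.ιMulti ℝ k ε = 0 := by
  simp [bivector, Finset.sum_mul, mul_assoc, ι_mul_ιMulti_self]

/-- Skew-symmetry makes the (i, j) and (j, i) terms equal, absorbing the factor ½. The next-to-last
vector pairs only with the last, so every term outside the first k vectors contains the last one,
which factors out on the right. -/
theorem bivector_succ_succ {M : Type*} [AddCommGroup M] [Module ℝ M] {k : ℕ}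
    (ε : Fin (k + 2) → M) (B : Fin (k + 2) → Fin (k + 2) → ℝ) (hB : ∀ i j, B i j = - B j i)
    (h : ∀ j : Fin k, B (Fin.last k).castSucc j.castSucc.castSucc = 0) :
    bivector ε B = bivector (fun i : Fin k => ε i.castSucc.castSucc)
      (fun i j => B i.castSucc.castSucc j.castSucc.castSucc) +
      ExteriorAlgebra.ι ℝ (B (Fin.last k).castSucc (Fin.last (k + 1)) • ε (Fin.last k).castSucc +
        ∑ i : Fin k, B i.castSucc.castSucc (Fin.last (k + 1)) • ε i.castSucc.castSucc) *
        ExteriorAlgebra.ι ℝ (ε (Fin.last (k + 1))) := by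
  have h' : ∀ j : Fin k, B j.castSucc.castSucc (Fin.last k).castSucc = 0 := fun j => by
    rw [hB, h, neg_zero]
  have hsw : ∀ i j, B i j • (ExteriorAlgebra.ι ℝ (ε i) * ExteriorAlgebra.ι ℝ (ε j)) =
      B j i • (ExteriorAlgebra.ι ℝ (ε j) * ExteriorAlgebra.ι ℝ (ε i)) := fun i j => by
    rw [hB, eq_neg_of_add_eq_zero_left (ExteriorAlgebra.ι_add_mul_swap (R := ℝ) (ε i) (ε j)),
      neg_smul, smul_neg, neg_neg]
  have hd : ∀ i, ExteriorAlgebra.ι ℝ (ε i) * ExteriorAlgebra.ι ℝ (ε i) = 0 := fun i =>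
    ExteriorAlgebra.ι_sq_zero _
  simp only [bivector, Fin.sum_univ_castSucc, Finset.sum_add_distrib, h, h', hd, zero_smul,
    smul_zero, add_zero, Finset.sum_const_zero, zero_add, map_add, map_smul, map_sum, add_mul,
    Finset.sum_mul, smul_mul_assoc]
  simp only [hsw (Fin.last (k + 1))]
  module

/-- Expansion of the Pfaffian along a row with a single nonzero entry. -/
theorem pfaff_succ (hA : ∀ v, inner ℝ (A v) v = 0) (hn : ∀ v, ‖A v‖ ≤ ‖v‖) {m k : ℕ}
    (hk : k = 2 * m) (e : Fin (k + 2) → F)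
    (h : ∀ j : Fin k, inner ℝ (A (e (Fin.last k).castSucc)) (e j.castSucc.castSucc) = 0) :
    pfaff A (m + 1) e = (m + 1) * inner ℝ (A (e (Fin.last k).castSucc)) (e (Fin.last (k + 1))) *
      pfaff A m (fun i : Fin k => e i.castSucc.castSucc) := by
  subst hk
  set ε : Fin (2 * m + 2) → (Fin (2 * m + 2) → ℝ) := ⇑(Pi.basisFun ℝ (Fin (2 * m + 2))) with hε
  set ε' : Fin (2 * m) → (Fin (2 * m + 2) → ℝ) := fun i => ε i.castSucc.castSucc with hε'
  set e' : Fin (2 * m) → F := fun i => e i.castSucc.castSucc with he'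
  have hskew : ∀ v w, inner ℝ (A v) w = - inner ℝ (A w) v := fun v w => by
    have := hA (v + w)
    simp only [map_add, inner_add_left, inner_add_right, hA] at this
    linarith
  -- The m-th power of the bivector in 2m variables has top degree. Its next power therefore
  -- vanishes, and multiplying it by any vector of ε' gives 0, so a single term survives the
  -- expansion.
  have hZ : bivector ε' (fun i j => inner ℝ (A (e' i)) (e' j)) ^ m =
      pfaff A m e' • ExteriorAlgebra.ιMulti ℝ (2 * m) ε' := by
    rw [bivector_pow_eq hA hn, toExt_top, pfaff_eq hA hn]
    rfl
  have hlast : ExteriorAlgebra.ιMulti ℝ (2 * m) ε' * ExteriorAlgebra.ι ℝ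
      (ε (Fin.last (2 * m)).castSucc) * ExteriorAlgebra.ι ℝ (ε (Fin.last (2 * m + 1))) =
      ExteriorAlgebra.ιMulti ℝ (2 * m + 2) ε := by
    rw [ιMulti_mul_ι, ιMulti_mul_ι]
    congr 1
    ext i : 1
    refine Fin.lastCases ?_ (fun i => Fin.lastCases ?_ (fun i => ?_) i) i <;> simp [hε']
  have hzero : ∀ j : Fin (2 * m), ExteriorAlgebra.ιMulti ℝ (2 * m) ε' *
      ExteriorAlgebra.ι ℝ (ε j.castSucc.castSucc) = 0 := ιMulti_mul_ι_self ε'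
  have htop : topCoeff (2 * m + 2) (ExteriorAlgebra.ιMulti ℝ (2 * m + 2) ε) = 1 := topCoeff_basis _
  rw [pfaff, ← hε, bivector_succ_succ _ _ (fun i j => hskew (e i) (e j)) h,
    add_pow_succ_of_mul_self_eq_zero, pow_succ', hZ, mul_smul_comm, bivector_mul_ιMulti, smul_zero,
    zero_add, map_nsmul, ← mul_assoc, map_add, mul_add, map_smul, map_sum, Finset.mul_sum]
  · simp only [map_smul, smul_mul_assoc, mul_smul_comm, hzero, smul_zero, Finset.sum_const_zero,
      add_zero, hlast, htop, smul_eq_mul, nsmul_eq_mul]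
    push_cast
    ring
  · exact ((Subalgebra.mem_center_iff.mp (bivector_mem_center _ _)) _).symm
  · rw [← mul_assoc, ι_mul_ι_mul_comm, ← mul_assoc, ExteriorAlgebra.ι_sq_zero, zero_mul, zero_mul]

end Wirtinger

/-! ### Wirtinger's inequality and its equality case -/

section Wirtinger

variable {F : Type*} [NormedAddCommGroup F] [InnerProductSpace ℝ F] {A : F →ₗ[ℝ] F}

theorem eq_sum_inner_smul_of_mem_span {ι : Type*} [Fintype ι] {b : ι → F} (hb : Orthonormal ℝ b)
    {u : F} (hu : u ∈ Submodule.span ℝ (Set.range b)) : u = ∑ i, inner ℝ (b i) u • b i := by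
  obtain ⟨c, rfl⟩ := (Submodule.mem_span_range_iff_exists_fun ℝ).mp hu
  simp only [hb.inner_right_fintype]

/-- An orthonormal basis of a subspace adapted to a vector `v₀` and a functional `⟪a, ·⟫`
vanishing on `v₀`. -/
theorem exists_adapted_orthonormal {k : ℕ} {e : Fin (k + 2) → F} (he : Orthonormal ℝ e) {v₀ a : F}
    (hv : v₀ ∈ Submodule.span ℝ (Set.range e)) (hv1 : ‖v₀‖ = 1) (ha : inner ℝ a v₀ = 0) :
    ∃ b : Fin (k + 2) → F, Orthonormal ℝ b ∧
      Submodule.span ℝ (Set.range b) = Submodule.span ℝ (Set.range e) ∧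
      b (Fin.last k).castSucc = v₀ ∧ ∀ j : Fin k, inner ℝ a (b j.castSucc.castSucc) = 0 := by
  set W := Submodule.span ℝ (Set.range e) with hW
  have : FiniteDimensional ℝ W := FiniteDimensional.span_of_finite ℝ (Set.finite_range e)
  -- On W the functional ⟪a, ·⟫ is represented by w, and w ⊥ v₀. Placing v₀ and w/‖w‖ in the last
  -- two slots leaves k basis vectors orthogonal to a; if w = 0, only v₀ needs to be prescribed.
  let w : W := W.orthogonalProjectionOnto a
  have hw : ∀ u : W, inner ℝ w u = inner ℝ a (u : F) := fun u => by
    simp [w]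
  have hcard : Module.finrank ℝ W = Fintype.card (Fin (k + 2)) :=
    finrank_span_eq_card he.linearIndependent
  let K : Fin (k + 2) := (Fin.last k).castSucc
  let v : Fin (k + 2) → W := fun i => if i = K then ⟨v₀, hv⟩ else (‖w‖⁻¹) • w
  have hvK : v K = ⟨v₀, hv⟩ := if_pos rfl
  have hLK : Fin.last (k + 1) ≠ K := (Fin.castSucc_ne_last _).symm
  have hvL : v (Fin.last (k + 1)) = (‖w‖⁻¹) • w := if_neg hLK
  suffices h : ∃ b : OrthonormalBasis (Fin (k + 2)) ℝ W, b K = ⟨v₀, hv⟩ ∧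
      ∀ j : Fin k, inner ℝ w (b j.castSucc.castSucc) = 0 by
    obtain ⟨b, hb1, hb2⟩ := h
    refine ⟨fun i => b i, W.subtypeₗᵢ.orthonormal_comp_iff.mpr b.orthonormal, ?_, ?_, ?_⟩
    · have h1 : Set.range (fun i => (b i : F)) = W.subtype '' Set.range b := by
        rw [← Set.range_comp]; rfl
      have h2 : Submodule.span ℝ (Set.range b) = ⊤ := by
        rw [← b.coe_toBasis]; exact b.toBasis.span_eq
      rw [h1, ← Submodule.map_span, h2, Submodule.map_subtype_top]
    · exact congrArg Subtype.val hb1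
    · intro j; rw [← hw, hb2]
  by_cases h0 : w = 0
  · obtain ⟨b, hb⟩ := Orthonormal.exists_orthonormalBasis_extension_of_card_eq hcard
      (v := v) (s := {K}) (by
        constructor
        · rintro ⟨i, rfl⟩
          simpa [hvK, Set.domRestrict] using hv1
        · rintro ⟨i, rfl⟩ ⟨j, rfl⟩ hij
          exact absurd rfl hij)
    exact ⟨b, (hb K rfl).trans hvK, fun j => by rw [h0, inner_zero_left]⟩
  · have hwn : ‖w‖ ≠ 0 := norm_ne_zero_iff.mpr h0
    have hort : inner ℝ (v K) (v (Fin.last (k + 1))) = 0 := by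
      rw [hvK, hvL, inner_smul_right, real_inner_comm, hw, ha, mul_zero]
    have hn1 : ‖v (Fin.last (k + 1))‖ = 1 := by
      rw [hvL, norm_smul, norm_inv, norm_norm, inv_mul_cancel₀ hwn]
    obtain ⟨b, hb⟩ := Orthonormal.exists_orthonormalBasis_extension_of_card_eq hcard
      (v := v) (s := {K, Fin.last (k + 1)}) (by
        constructor
        · rintro ⟨i, rfl | rfl⟩
          · simpa [hvK, Set.domRestrict] using hv1
          · exact hn1
        · rintro ⟨i, rfl | rfl⟩ ⟨j, rfl | rfl⟩ hij
          · exact absurd rfl hij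
          · exact hort
          · exact (real_inner_comm _ _).trans hort
          · exact absurd rfl hij)
    refine ⟨b, (hb K (by simp)).trans hvK, fun j => ?_⟩
    have h1 : w = ‖w‖ • b (Fin.last (k + 1)) := by
      rw [hb _ (by simp), hvL, smul_inv_smul₀ hwn]
    rw [h1, inner_smul_left, b.orthonormal.2 (Fin.castSucc_ne_last _).symm, mul_zero]

/-- The inductive step common to the inequality and both directions of its equality case. In a basis
adapted to v₀ and A v₀ the Pfaffian has a row with one nonzero entry; changing to that basis costs
only a sign. -/
theorem abs_pfaff_eq (hA : ∀ v, inner ℝ (A v) v = 0) (hn : ∀ v, ‖A v‖ ≤ ‖v‖) {m k : ℕ}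
    (hk : k = 2 * m) {e : Fin (k + 2) → F} (he : Orthonormal ℝ e) {v₀ : F}
    (hv : v₀ ∈ Submodule.span ℝ (Set.range e)) (hv1 : ‖v₀‖ = 1) :
    ∃ b : Fin (k + 2) → F, Orthonormal ℝ b ∧
      Submodule.span ℝ (Set.range b) = Submodule.span ℝ (Set.range e) ∧
      b (Fin.last k).castSucc = v₀ ∧ (∀ j : Fin k, inner ℝ (A v₀) (b j.castSucc.castSucc) = 0) ∧
      |pfaff A (m + 1) e| = (m + 1) * |inner ℝ (A v₀) (b (Fin.last (k + 1)))| *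
        |pfaff A m (fun i : Fin k => b i.castSucc.castSucc)| := by
  obtain ⟨b, hb, hs, hb0, hbj⟩ := exists_adapted_orthonormal he hv hv1 (hA v₀)
  refine ⟨b, hb, hs, hb0, hbj, ?_⟩
  have h1 : |pfaff A (m + 1) e| = |pfaff A (m + 1) b| := by
    subst hk
    rw [pfaff_eq hA hn (m + 1) e, pfaff_eq hA hn (m + 1) b]
    exact abs_apply_eq_of_span_eq (wedgePow (skewForm A hA hn) (m + 1)).toAlternatingMap he hb
      hs.symm
  rw [h1, pfaff_succ hA hn hk b (by rw [hb0]; exact hbj), hb0, abs_mul, abs_mul,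
    abs_of_nonneg (by positivity : (0 : ℝ) ≤ m + 1)]

/-- **Wirtinger's inequality**. -/
theorem abs_pfaff_le (hA : ∀ v, inner ℝ (A v) v = 0) (hn : ∀ v, ‖A v‖ ≤ ‖v‖) (m : ℕ) {n : ℕ}
    (hnm : n = 2 * m) {e : Fin n → F} (he : Orthonormal ℝ e) : |pfaff A m e| ≤ m.factorial := by
  induction m generalizing n with
  | zero =>
    subst hnm
    rw [pfaff_eq hA hn 0 e]
    simp [wedgePow]
  | succ m ih =>
    subst hnm
    -- Any unit vector of the span would serve as v₀. The split-off entry is at most 1 by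
    -- Cauchy–Schwarz, and the factors m+1 accumulate to the factorial.
    obtain ⟨b, hb, -, hb0, -, hp⟩ := abs_pfaff_eq hA hn (k := 2 * m) rfl he
      (Submodule.subset_span (Set.mem_range_self 0)) (he.1 0)
    have h1 := ih (n := 2 * m) rfl (e := fun i => b i.castSucc.castSucc)
      (hb.comp _ ((Fin.castSucc_injective _).comp (Fin.castSucc_injective _)))
    have h2 : |inner ℝ (A (e 0)) (b (Fin.last (2 * m + 1)))| ≤ 1 := by
      refine (abs_real_inner_le_norm _ _).trans ?_
      rw [hb.1, mul_one]
      exact (hn _).trans (he.1 0).le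
    refine hp.le.trans ?_
    rw [Nat.factorial_succ]
    push_cast
    have : (m + 1 : ℝ) * |inner ℝ (A (e 0)) (b (Fin.last (2 * m + 1)))| ≤ m + 1 :=
      mul_le_of_le_one_right (by positivity) h2
    exact mul_le_mul this h1 (abs_nonneg _) (by positivity)

/-- The equality case of Wirtinger's inequality. -/
theorem map_mem_span_of_abs_pfaff_eq (hA : ∀ v, inner ℝ (A v) v = 0) (hn : ∀ v, ‖A v‖ ≤ ‖v‖)
    (m : ℕ) {n : ℕ} (hnm : n = 2 * m) {e : Fin n → F} (he : Orthonormal ℝ e)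
    (heq : |pfaff A m e| = m.factorial) {v : F} (hv : v ∈ Submodule.span ℝ (Set.range e)) :
    A v ∈ Submodule.span ℝ (Set.range e) := by
  by_cases hv0 : v = 0
  · rw [hv0, map_zero]; exact zero_mem _
  have hvn : ‖v‖ ≠ 0 := norm_ne_zero_iff.mpr hv0
  cases m with
  | zero =>
    subst hnm
    have : Set.range e = ∅ := Set.range_eq_empty_iff.mpr (inferInstanceAs (IsEmpty (Fin 0)))
    rw [this, Submodule.span_empty, Submodule.mem_bot] at hv
    exact absurd hv hv0
  | succ m =>
    subst hnm
    have hu1 : ‖‖v‖⁻¹ • v‖ = 1 := by rw [norm_smul, norm_inv, norm_norm, inv_mul_cancel₀ hvn]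
    obtain ⟨b, hb, hs, hb0, -, hp⟩ := abs_pfaff_eq hA hn (k := 2 * m) rfl he
      (Submodule.smul_mem _ (‖v‖⁻¹) hv) hu1
    have h1 := abs_pfaff_le hA hn m (n := 2 * m) rfl (e := fun i => b i.castSucc.castSucc)
      (hb.comp _ ((Fin.castSucc_injective _).comp (Fin.castSucc_injective _)))
    set x := A (‖v‖⁻¹ • v) with hx
    set y := b (Fin.last (2 * m + 1)) with hy
    have hxn : ‖x‖ ≤ 1 := (hn _).trans hu1.le
    have hyn : ‖y‖ = 1 := hb.1 _
    -- A smaller entry would make the product strictly less than (m+1)!, since the remaining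
    -- Pfaffian is at most m!.
    have h2 : 1 ≤ |inner ℝ x y| := by
      by_contra hlt
      push Not at hlt
      have h3 : (0 : ℝ) < (m + 1) * m.factorial := by positivity
      have h4 := heq.symm.trans hp
      rw [Nat.factorial_succ] at h4
      push_cast at h4
      have h5 : (m + 1) * |inner ℝ x y| * |pfaff A m fun i : Fin (2 * m) => b i.castSucc.castSucc|
          ≤ (m + 1) * |inner ℝ x y| * m.factorial :=
        mul_le_mul_of_nonneg_left h1 (by positivity)
      nlinarith
    -- Equality case of Cauchy–Schwarz: ‖x - ⟪x, y⟫y‖² = ‖x‖² - ⟪x, y⟫² ≤ 0. Hence A v is a multiple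
    -- of a basis vector of the span.
    have h3 : x = inner ℝ x y • y := by
      rw [← sub_eq_zero, ← norm_eq_zero, ← sq_eq_zero_iff]
      refine le_antisymm ?_ (sq_nonneg _)
      rw [norm_sub_sq_real, inner_smul_right, norm_smul, hyn, Real.norm_eq_abs, mul_one, sq_abs]
      have h4 : 1 ≤ inner ℝ x y ^ 2 := by rw [← sq_abs]; exact one_le_pow₀ h2
      have h5 : ‖x‖ ^ 2 ≤ 1 := pow_le_one₀ (norm_nonneg _) hxn
      nlinarith
    have h4 : x ∈ Submodule.span ℝ (Set.range e) := by
      rw [h3, ← hs]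
      exact Submodule.smul_mem _ _ (Submodule.subset_span (Set.mem_range_self _))
    rw [hx, map_smul] at h4
    exact (Submodule.smul_mem_iff _ (inv_ne_zero hvn)).mp h4

/-- By invariance A e₀ lies in the span, and it is orthogonal to every adapted basis vector except
the last, so it is ± that vector and the split-off entry is ±1. The orthogonal complement of e₀ and
A e₀ in the span is again A-invariant, since A is isometric and skew; induction applies to it. -/
theorem abs_pfaff_eq_factorial (hA : ∀ v, inner ℝ (A v) v = 0)
    (hiso : ∀ v w, inner ℝ (A v) (A w) = inner ℝ v w) (m : ℕ) {n : ℕ} (hnm : n = 2 * m)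
    {e : Fin n → F} (he : Orthonormal ℝ e)
    (hinv : ∀ v ∈ Submodule.span ℝ (Set.range e), A v ∈ Submodule.span ℝ (Set.range e)) :
    |pfaff A m e| = m.factorial := by
  have hnorm : ∀ v, ‖A v‖ = ‖v‖ := fun v => by
    rw [norm_eq_sqrt_real_inner, hiso, ← norm_eq_sqrt_real_inner]
  have hn : ∀ v, ‖A v‖ ≤ ‖v‖ := fun v => (hnorm v).le
  have hskew : ∀ v w, inner ℝ (A v) w = - inner ℝ v (A w) := fun v w => by
    have := hA (v + w)
    simp only [map_add, inner_add_left, inner_add_right, hA] at this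
    rw [real_inner_comm (A w)]
    linarith
  induction m generalizing n with
  | zero =>
    subst hnm
    rw [pfaff_eq hA hn 0 e]
    simp [wedgePow]
  | succ m ih =>
    subst hnm
    obtain ⟨b, hb, hs, hb0, hbj, hp⟩ := abs_pfaff_eq hA hn (k := 2 * m) rfl he
      (Submodule.subset_span (Set.mem_range_self 0)) (he.1 0)
    set y := b (Fin.last (2 * m + 1)) with hy
    have hx : A (e 0) ∈ Submodule.span ℝ (Set.range b) := by
      rw [hs]
      exact hinv _ (Submodule.subset_span (Set.mem_range_self 0))
    have hAe : A (e 0) = inner ℝ (A (e 0)) y • y := by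
      have hA0 : inner ℝ (e 0) (A (e 0)) = 0 := by rw [real_inner_comm, hA]
      have := eq_sum_inner_smul_of_mem_span hb hx
      rw [Fin.sum_univ_castSucc, Fin.sum_univ_castSucc] at this
      simp only [fun i => real_inner_comm (A (e 0)) (b i), hbj, hb0, hA0, zero_smul,
        Finset.sum_const_zero, zero_add] at this
      exact this
    have hβ : |inner ℝ (A (e 0)) y| = 1 := by
      have := congrArg norm hAe
      rw [norm_smul, hnorm, he.1, hb.1, mul_one] at this
      exact this.symm
    have hβ0 : inner ℝ (A (e 0)) y ≠ 0 := by
      intro h0; rw [h0, abs_zero] at hβ; exact zero_ne_one hβ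
    have hb' : Orthonormal ℝ (fun i : Fin (2 * m) => b i.castSucc.castSucc) :=
      hb.comp _ ((Fin.castSucc_injective _).comp (Fin.castSucc_injective _))
    have h1 := ih (n := 2 * m) rfl hb' (by
      intro u hu
      have hub : u ∈ Submodule.span ℝ (Set.range b) :=
        Submodule.span_mono (by rintro _ ⟨i, rfl⟩; exact ⟨_, rfl⟩) hu
      have huo : ∀ i : Fin (2 * m + 2), (∀ j : Fin (2 * m), j.castSucc.castSucc ≠ i) →
          inner ℝ u (b i) = 0 := by
        intro i hi
        rw [eq_sum_inner_smul_of_mem_span hb' hu, sum_inner]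
        refine Finset.sum_eq_zero fun j _ => ?_
        rw [inner_smul_left, hb.2 (hi j), mul_zero]
      have hK := huo (Fin.last (2 * m)).castSucc (by
        intro j h; exact Fin.castSucc_ne_last j (Fin.castSucc_injective _ h))
      have hL := huo (Fin.last (2 * m + 1)) (fun j => Fin.castSucc_ne_last _)
      have hAu : A u ∈ Submodule.span ℝ (Set.range b) := by rw [hs] at hub ⊢; exact hinv u hub
      have hAK : inner ℝ (b (Fin.last (2 * m)).castSucc) (A u) = 0 := by
        rw [real_inner_comm, hskew, hb0, hAe, inner_smul_right, hL, mul_zero, neg_zero]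
      have hAL : inner ℝ (b (Fin.last (2 * m + 1))) (A u) = 0 := by
        have h2 : inner ℝ (A (e 0)) (A u) = 0 := by
          rw [hiso, real_inner_comm, ← hb0, hK]
        rw [hAe, inner_smul_left] at h2
        exact (mul_eq_zero.mp h2).resolve_left hβ0
      rw [eq_sum_inner_smul_of_mem_span hb hAu, Fin.sum_univ_castSucc, Fin.sum_univ_castSucc, hAK,
        hAL, zero_smul, zero_smul, add_zero, add_zero]
      exact Submodule.sum_mem _ fun i _ => Submodule.smul_mem _ _
        (Submodule.subset_span (Set.mem_range_self i)))
    refine hp.trans ?_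
    rw [hβ, h1, mul_one, Nat.factorial_succ]
    push_cast
    rfl

end Wirtinger

/-! ### Averages of powers of linear forms over the circle and the sphere -/

section Average

open Real

variable {R : Type*} [CommRing R] [Algebra ℝ R] (T : R →ₗ[ℝ] ℝ)

theorem mul_map_eq_map_smul (c : ℝ) (r : R) : c * T r = T (c • r) := (T.map_smul c r).symm

/-- R carries no topology, so only the scalar function is differentiated. Linearity of T splits off
one factor of the power, and the multiplier w absorbs it in the induction. -/
theorem hasDerivAt_map_pow (y z w : R) (n : ℕ) (θ : ℝ) :
    HasDerivAt (fun θ : ℝ => T (w * (cos θ • y + sin θ • z) ^ (n + 1)))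
      ((n + 1) * T (w * (cos θ • y + sin θ • z) ^ n * (-sin θ • y + cos θ • z))) θ := by
  have hexp : ∀ (n : ℕ) (w : R) (θ : ℝ), T (w * (cos θ • y + sin θ • z) ^ (n + 1)) =
      cos θ * T (w * y * (cos θ • y + sin θ • z) ^ n) +
      sin θ * T (w * z * (cos θ • y + sin θ • z) ^ n) := by
    intro n w θ
    rw [mul_map_eq_map_smul, mul_map_eq_map_smul, ← map_add]
    congr 1
    simp only [Algebra.smul_def]
    ring
  induction n generalizing w with
  | zero =>
    simp only [hexp, pow_zero, mul_one]
    refine (((hasDerivAt_cos θ).mul_const (T (w * y))).add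
      ((hasDerivAt_sin θ).mul_const (T (w * z)))).congr_deriv ?_
    simp [mul_add]
  | succ n ih =>
    simp only [hexp (n + 1)]
    refine (((hasDerivAt_cos θ).mul (ih (w * y))).add
      ((hasDerivAt_sin θ).mul (ih (w * z)))).congr_deriv ?_
    simp only [mul_map_eq_map_smul, ← map_add]
    congr 1
    simp only [Algebra.smul_def]
    push_cast
    ring

theorem continuous_map_pow (y z w : R) (n : ℕ) :
    Continuous fun θ : ℝ => T (w * (cos θ • y + sin θ • z) ^ n) := by
  cases n with
  | zero => simpa using continuous_const
  | succ n =>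
    exact continuous_iff_continuousAt.mpr fun θ => (hasDerivAt_map_pow T y z w n θ).continuousAt

theorem integral_circle_succ (y z w : R) (q : ℕ) :
    (2 * q + 2) * ∫ θ in (0)..(2 * π), T (w * (cos θ • y + sin θ • z) ^ (2 * (q + 1))) =
      (2 * q + 1) * ∫ θ in (0)..(2 * π),
        T (w * (y ^ 2 + z ^ 2) * (cos θ • y + sin θ • z) ^ (2 * q)) := by
  -- With ℓ = cos θ • y + sin θ • z this is the derivative of T(w ℓ' ℓ^(2q+1)), computed from ℓ'' =
  -- -ℓ and ℓ² + ℓ'² = y² + z². The function is 2π-periodic, so its derivative integrates to 0.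
  have hd : ∀ θ : ℝ, HasDerivAt
      (fun θ : ℝ => -sin θ * T (w * y * (cos θ • y + sin θ • z) ^ (2 * q + 1)) +
        cos θ * T (w * z * (cos θ • y + sin θ • z) ^ (2 * q + 1)))
      ((2 * q + 1) * T (w * (y ^ 2 + z ^ 2) * (cos θ • y + sin θ • z) ^ (2 * q)) -
        (2 * q + 2) * T (w * (cos θ • y + sin θ • z) ^ (2 * (q + 1)))) θ := by
    intro θ
    refine ((((hasDerivAt_sin θ).neg).mul (hasDerivAt_map_pow T y z (w * y) (2 * q) θ)).add
      ((hasDerivAt_cos θ).mul (hasDerivAt_map_pow T y z (w * z) (2 * q) θ))).congr_deriv ?_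
    simp only [mul_map_eq_map_smul, ← map_add, ← map_sub, Pi.neg_apply]
    congr 1
    have hcs : algebraMap ℝ R (sin θ) ^ 2 = 1 - algebraMap ℝ R (cos θ) ^ 2 := by
      rw [← map_pow, ← map_pow, sin_sq, map_sub, map_one]
    simp only [Algebra.smul_def]
    push_cast
    simp only [map_ofNat]
    linear_combination (2 * (q : R) + 1) * w * (y ^ 2 + z ^ 2) *
      (algebraMap ℝ R (cos θ) * y + algebraMap ℝ R (sin θ) * z) ^ (2 * q) * hcs
  have h := intervalIntegral.integral_eq_sub_of_hasDerivAt (a := 0) (b := 2 * π)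
    (fun θ _ => hd θ) ((((continuous_map_pow T y z _ _).const_mul _).sub
      ((continuous_map_pow T y z _ _).const_mul _)).intervalIntegrable _ _)
  rw [intervalIntegral.integral_sub
    (((continuous_map_pow T y z _ _).const_mul _).intervalIntegrable _ _)
    (((continuous_map_pow T y z _ _).const_mul _).intervalIntegrable _ _),
    intervalIntegral.integral_const_mul, intervalIntegral.integral_const_mul] at h
  simp only [sin_two_pi, cos_two_pi, sin_zero, cos_zero, sub_self] at h
  linarith

/-- `(y² + z²)^q` as an average of powers of linear forms over the circle. -/
theorem integral_circle (y z w : R) (q : ℕ) :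
    4 ^ q * (q.factorial : ℝ) ^ 2 *
        ∫ θ in (0)..(2 * π), T (w * (cos θ • y + sin θ • z) ^ (2 * q)) =
      2 * π * (2 * q).factorial * T (w * (y ^ 2 + z ^ 2) ^ q) := by
  induction q generalizing w with
  | zero => simp
  | succ q ih =>
    have h1 := integral_circle_succ T y z w q
    have h2 := ih (w * (y ^ 2 + z ^ 2))
    rw [mul_assoc w, ← pow_succ'] at h2
    have h3 : ((2 * (q + 1)).factorial : ℝ) = (2 * q + 2) * (2 * q + 1) * (2 * q).factorial := by
      rw [show 2 * (q + 1) = 2 * q + 1 + 1 by ring, Nat.factorial_succ, Nat.factorial_succ]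
      push_cast; ring
    rw [h3, Nat.factorial_succ, pow_succ]
    push_cast
    linear_combination (2 * (q + 1) * 4 ^ q * (q.factorial : ℝ) ^ 2) * h1 +
      (2 * (q + 1) * (2 * q + 1)) * h2

/-- Integration by parts; the boundary terms vanish because sin is 0 at both ends. -/
theorem integral_sin_mul_cos_pow_even_succ (a b : ℕ) :
    (2 * a + 1) * ∫ φ in (0)..π, sin φ ^ (2 * (b + 1) + 1) * cos φ ^ (2 * a) =
      (2 * b + 2) * ∫ φ in (0)..π, sin φ ^ (2 * b + 1) * cos φ ^ (2 * (a + 1)) := by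
  have hd : ∀ φ : ℝ, HasDerivAt (fun φ : ℝ => sin φ ^ (2 * b + 2) * cos φ ^ (2 * a + 1))
      ((2 * b + 2) * (sin φ ^ (2 * b + 1) * cos φ ^ (2 * (a + 1))) -
        (2 * a + 1) * (sin φ ^ (2 * (b + 1) + 1) * cos φ ^ (2 * a))) φ := by
    intro φ
    refine (((hasDerivAt_sin φ).pow (2 * b + 2)).mul
      ((hasDerivAt_cos φ).pow (2 * a + 1))).congr_deriv ?_
    simp only [Nat.add_sub_cancel, show 2 * b + 2 - 1 = 2 * b + 1 by omega]
    push_cast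
    simp only [Pi.pow_apply]
    ring
  have h := intervalIntegral.integral_eq_sub_of_hasDerivAt (a := 0) (b := π)
    (fun θ _ => hd θ) ((by fun_prop : Continuous _).intervalIntegrable _ _)
  rw [intervalIntegral.integral_sub ((by fun_prop : Continuous _).intervalIntegrable _ _)
    ((by fun_prop : Continuous _).intervalIntegrable _ _),
    intervalIntegral.integral_const_mul, intervalIntegral.integral_const_mul] at h
  simp at h
  linarith

theorem integral_sin_pow_odd_mul_cos_pow_even (a b : ℕ) :
    (2 * (a + b) + 1).factorial * a.factorial *
        ∫ φ in (0)..π, sin φ ^ (2 * b + 1) * cos φ ^ (2 * a) =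
      2 * (2 * a).factorial * b.factorial * 4 ^ b * (a + b).factorial := by
  induction b generalizing a with
  | zero =>
    have hd : ∀ φ : ℝ, HasDerivAt (fun φ : ℝ => -cos φ ^ (2 * a + 1))
        ((2 * a + 1) * (sin φ ^ (2 * 0 + 1) * cos φ ^ (2 * a))) φ := by
      intro φ
      refine ((hasDerivAt_cos φ).pow (2 * a + 1)).neg.congr_deriv ?_
      simp only [Nat.add_sub_cancel]
      push_cast
      ring
    have h := intervalIntegral.integral_eq_sub_of_hasDerivAt (a := 0) (b := π)
      (fun θ _ => hd θ) ((by fun_prop : Continuous _).intervalIntegrable _ _)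
    rw [intervalIntegral.integral_const_mul] at h
    have h1 : (-1 : ℝ) ^ (2 * a + 1) = -1 := (odd_two_mul_add_one a).neg_one_pow
    simp only [cos_pi, cos_zero, h1, one_pow] at h
    rw [add_zero, Nat.factorial_succ]
    push_cast
    linear_combination ((2 * a).factorial * a.factorial : ℝ) * h
  | succ b ih =>
    have h1 := integral_sin_mul_cos_pow_even_succ a b
    have h2 := ih (a + 1)
    have h3 : ((2 * (a + 1)).factorial : ℝ) = (2 * a + 2) * (2 * a + 1) * (2 * a).factorial := by
      rw [show 2 * (a + 1) = 2 * a + 1 + 1 by ring, Nat.factorial_succ, Nat.factorial_succ]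
      push_cast; ring
    rw [h3, show a + 1 + b = a + (b + 1) by ring, Nat.factorial_succ a] at h2
    rw [Nat.factorial_succ b, pow_succ]
    push_cast at h2 ⊢
    have h4 : (2 * a + 1 : ℝ) * (a + 1) ≠ 0 := by positivity
    apply mul_left_cancel₀ h4
    linear_combination ((2 * (a + (b + 1)) + 1).factorial * a.factorial * (a + 1) : ℝ) * h1 +
      (2 * b + 2) * h2

/-- The reflection φ ↦ π - φ changes the sign of the integrand. -/
theorem integral_sin_pow_mul_cos_pow_odd_eq_zero (l : ℕ) {k : ℕ} (hk : Odd k) :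
    ∫ φ in (0)..π, sin φ ^ l * cos φ ^ k = 0 := by
  have h := intervalIntegral.integral_comp_sub_left (a := 0) (b := π)
    (fun φ => sin φ ^ l * cos φ ^ k) π
  simp only [sin_pi_sub, cos_pi_sub, hk.neg_pow, mul_neg, intervalIntegral.integral_neg, sub_zero,
    sub_self] at h
  linarith

theorem sum_range_two_mul_add_one_of_odd_eq_zero {f : ℕ → ℝ} (hf : ∀ k, Odd k → f k = 0) (p : ℕ) :
    ∑ m ∈ Finset.range (2 * p + 1), f m = ∑ k ∈ Finset.range (p + 1), f (2 * k) := by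
  induction p with
  | zero => simp
  | succ p ih =>
    rw [show 2 * (p + 1) + 1 = 2 * p + 1 + 1 + 1 by ring, Finset.sum_range_succ,
      Finset.sum_range_succ, ih, hf _ (odd_two_mul_add_one p), add_zero,
      Finset.sum_range_succ _ (p + 1)]
    rfl

/-- Binomial expansion: odd powers of cos integrate to 0 and even ones give Beta integrals. The
factor sin φ is the area density of the sphere. The coefficients are arranged to cancel those of
`integral_circle` when y rotates. -/
theorem integral_meridian (x y : R) (p : ℕ) :
    (2 * p + 1) * ∫ φ in (0)..π, sin φ * T ((cos φ • x + sin φ • y) ^ (2 * p)) =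
      2 * ∑ k ∈ Finset.range (p + 1), p.choose k *
        (4 ^ (p - k) * ((p - k).factorial : ℝ) ^ 2 / (2 * (p - k)).factorial *
          T (x ^ (2 * k) * y ^ (2 * (p - k)))) := by
  have h1 : ∀ φ : ℝ, sin φ * T ((cos φ • x + sin φ • y) ^ (2 * p)) =
      ∑ m ∈ Finset.range (2 * p + 1), ((2 * p).choose m * T (x ^ m * y ^ (2 * p - m))) *
        (sin φ ^ (2 * p - m + 1) * cos φ ^ m) := by
    intro φ
    rw [add_pow, map_sum, Finset.mul_sum]
    refine Finset.sum_congr rfl fun m _ => ?_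
    rw [smul_pow, smul_pow, smul_mul_smul_comm, ← nsmul_eq_mul', ← Nat.cast_smul_eq_nsmul ℝ,
      map_smul, map_smul, smul_eq_mul, smul_eq_mul]
    ring
  simp only [h1]
  rw [intervalIntegral.integral_finsetSum
    fun m _ => (by fun_prop : Continuous _).intervalIntegrable _ _]
  simp only [intervalIntegral.integral_const_mul]
  rw [sum_range_two_mul_add_one_of_odd_eq_zero fun k hk => by
    rw [integral_sin_pow_mul_cos_pow_odd_eq_zero _ hk, mul_zero], Finset.mul_sum, Finset.mul_sum]
  refine Finset.sum_congr rfl fun k hk => ?_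
  obtain ⟨q, rfl⟩ := Nat.exists_eq_add_of_le (Nat.lt_succ_iff.mp (Finset.mem_range.mp hk))
  have h2 := integral_sin_pow_odd_mul_cos_pow_even k q
  rw [show 2 * (k + q) - 2 * k = 2 * q by omega, Nat.add_sub_cancel_left]
  have h3 : (∫ φ in (0)..π, sin φ ^ (2 * q + 1) * cos φ ^ (2 * k)) =
      2 * (2 * k).factorial * q.factorial * 4 ^ q * (k + q).factorial /
        ((2 * (k + q) + 1).factorial * k.factorial) := by
    rw [eq_div_iff (by positivity), mul_comm, h2]
  rw [h3, Nat.cast_choose ℝ (show 2 * k ≤ 2 * (k + q) by omega),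
    Nat.cast_choose ℝ (Nat.le_add_right k q),
    show 2 * (k + q) - 2 * k = 2 * q by omega, Nat.add_sub_cancel_left, Nat.factorial_succ]
  push_cast
  field_simp

/-- `(x² + y² + z²)^p` as an average of powers of linear forms over the sphere. -/
theorem integral_sphere (x y z : R) (p : ℕ) :
    (2 * p + 1) * ∫ θ in (0)..(2 * π), ∫ φ in (0)..π,
        sin φ * T ((cos φ • x + sin φ • (cos θ • y + sin θ • z)) ^ (2 * p)) =
      4 * π * T ((x ^ 2 + y ^ 2 + z ^ 2) ^ p) := by
  rw [← intervalIntegral.integral_const_mul]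
  simp only [integral_meridian]
  rw [intervalIntegral.integral_const_mul, intervalIntegral.integral_finsetSum
    fun m _ => ((continuous_map_pow T y z _ _).const_mul _ |>.const_mul _).intervalIntegrable _ _]
  simp only [intervalIntegral.integral_const_mul]
  -- Averaging over θ turns the rotated power of degree 2(p-k) into (y² + z²)^(p-k), and the sum
  -- over k becomes a binomial expansion.
  rw [show x ^ 2 + y ^ 2 + z ^ 2 = x ^ 2 + (y ^ 2 + z ^ 2) by ring, add_pow, map_sum,
    Finset.mul_sum, Finset.mul_sum]
  refine Finset.sum_congr rfl fun k _ => ?_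
  have h := integral_circle T y z (x ^ (2 * k)) (p - k)
  rw [← nsmul_eq_mul', map_nsmul, nsmul_eq_mul, ← pow_mul]
  have h2 : ((2 * (p - k)).factorial : ℝ) ≠ 0 := by positivity
  rw [div_mul_eq_mul_div, h]
  field_simp
  ring

/-- The closed form of the inner integral is a finite sum of functions continuous in θ. -/
theorem continuous_integral_meridian (x y z : R) (p : ℕ) : Continuous fun θ : ℝ =>
    ∫ φ in (0)..π, sin φ * T ((cos φ • x + sin φ • (cos θ • y + sin θ • z)) ^ (2 * p)) := by
  have h : ∀ θ : ℝ,
      ∫ φ in (0)..π, sin φ * T ((cos φ • x + sin φ • (cos θ • y + sin θ • z)) ^ (2 * p)) =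
      (2 * p + 1 : ℝ)⁻¹ * (2 * ∑ k ∈ Finset.range (p + 1), p.choose k *
        (4 ^ (p - k) * ((p - k).factorial : ℝ) ^ 2 / (2 * (p - k)).factorial *
          T (x ^ (2 * k) * (cos θ • y + sin θ • z) ^ (2 * (p - k))))) := fun θ => by
    rw [← integral_meridian, inv_mul_cancel_left₀ (by positivity)]
  simp only [h]
  exact ((continuous_finsetSum _ fun k _ =>
    ((continuous_map_pow T y z _ _).const_mul _).const_mul _).const_mul _).const_mul _

end Average

/-- The defining sum satisfies c_{p+1} = 4(p+1)² c_p + (2p+2)!, and so does (2p+1)!. This identifies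
c_p with (2p+1) · (2p)!, the constant produced by the sphere average. -/
theorem HyperkahlerStructure.c_eq (p : ℕ) : HyperkahlerStructure.c p = (2 * p + 1).factorial := by
  induction p with
  | zero => simp [HyperkahlerStructure.c]
  | succ p ih =>
    have h1 : HyperkahlerStructure.c (p + 1) =
        4 * (p + 1) ^ 2 * HyperkahlerStructure.c p + (2 * (p + 1)).factorial := by
      rw [HyperkahlerStructure.c, Finset.sum_range_succ, HyperkahlerStructure.c, Finset.mul_sum]
      congr 1
      · refine Finset.sum_congr rfl fun k hk => ?_
        rw [Nat.sub_add_comm (Nat.lt_succ_iff.mp (Finset.mem_range.mp hk)), Nat.factorial_succ,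
          pow_succ]
        push_cast
        ring
      · rw [Nat.sub_self, pow_zero, mul_one, div_self (by positivity), one_mul]
    rw [h1, ih, show 2 * (p + 1) + 1 = 2 * p + 1 + 1 + 1 by ring,
      show 2 * (p + 1) = 2 * p + 1 + 1 by ring, Nat.factorial_succ (2 * p + 1 + 1),
      Nat.factorial_succ (2 * p + 1)]
    push_cast
    ring

/-! ### Bounds for averages and their equality cases -/

section Average

open Real

theorem integral_le_mul_of_le {f : ℝ → ℝ} {a b C : ℝ} (hab : a < b) (hf : Continuous f)
    (h : ∀ t ∈ Set.Icc a b, f t ≤ C) : ∫ t in a..b, f t ≤ (b - a) * C := by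
  have := intervalIntegral.integral_mono_on (μ := MeasureTheory.volume) hab.le
    (hf.intervalIntegrable a b) ((continuous_const (y := C)).intervalIntegrable a b) h
  simpa using this

theorem eq_of_integral_eq {f g : ℝ → ℝ} {a b : ℝ} (hab : a < b) (hf : Continuous f)
    (hg : Continuous g) (h : ∀ t ∈ Set.Icc a b, f t ≤ g t)
    (heq : ∫ t in a..b, f t = ∫ t in a..b, g t) : ∀ t ∈ Set.Icc a b, f t = g t := by
  intro t ht
  by_contra hne
  have hlt : 0 < g t - f t := sub_pos.mpr (lt_of_le_of_ne (h t ht) hne)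
  have := intervalIntegral.integral_pos hab (hg.sub hf).continuousOn
    (fun s hs => sub_nonneg.mpr (h s (Set.Ioc_subset_Icc_self hs))) ⟨t, ht, hlt⟩
  simp only [Pi.sub_apply] at this
  rw [intervalIntegral.integral_sub (hg.intervalIntegrable _ _) (hf.intervalIntegrable _ _), heq,
    sub_self] at this
  exact lt_irrefl _ this

variable {R : Type*} [CommRing R] [Algebra ℝ R] (T : R →ₗ[ℝ] ℝ)

theorem integral_circle_one (y z : R) (q : ℕ) :
    4 ^ q * (q.factorial : ℝ) ^ 2 * ∫ θ in (0)..(2 * π), T ((cos θ • y + sin θ • z) ^ (2 * q)) =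
      2 * π * (2 * q).factorial * T ((y ^ 2 + z ^ 2) ^ q) := by
  simpa using integral_circle T y z 1 q

theorem continuous_map_pow_one (y z : R) (n : ℕ) :
    Continuous fun θ : ℝ => T ((cos θ • y + sin θ • z) ^ n) := by
  simpa using continuous_map_pow T y z 1 n

theorem map_circle_le {y z : R} {q : ℕ}
    (h : ∀ θ : ℝ, T ((cos θ • y + sin θ • z) ^ (2 * q)) ≤ (2 * q).factorial) :
    T ((y ^ 2 + z ^ 2) ^ q) ≤ (q.factorial : ℝ) ^ 2 * 4 ^ q := by
  have h1 := integral_le_mul_of_le two_pi_pos (continuous_map_pow_one T y z (2 * q))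
    fun θ _ => h θ
  have h2 := integral_circle_one T y z q
  have h3 := mul_le_mul_of_nonneg_left h1 (by positivity : 0 ≤ 4 ^ q * (q.factorial : ℝ) ^ 2)
  rw [h2] at h3
  have h4 : 0 < 2 * π * ((2 * q).factorial : ℝ) := by positivity
  refine le_of_mul_le_mul_left (h3.trans_eq ?_) h4
  ring

theorem map_circle_eq {y z : R} {q : ℕ}
    (h : ∀ θ : ℝ, T ((cos θ • y + sin θ • z) ^ (2 * q)) = (2 * q).factorial) :
    T ((y ^ 2 + z ^ 2) ^ q) = (q.factorial : ℝ) ^ 2 * 4 ^ q := by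
  have h2 := integral_circle_one T y z q
  simp only [h, intervalIntegral.integral_const, sub_zero, smul_eq_mul] at h2
  have h4 : 2 * π * ((2 * q).factorial : ℝ) ≠ 0 := by positivity
  apply mul_left_cancel₀ h4
  rw [← h2]
  ring

theorem circle_eq_of_map_eq {y z : R} {q : ℕ}
    (h : ∀ θ : ℝ, T ((cos θ • y + sin θ • z) ^ (2 * q)) ≤ (2 * q).factorial)
    (heq : T ((y ^ 2 + z ^ 2) ^ q) = (q.factorial : ℝ) ^ 2 * 4 ^ q) :
    ∀ θ ∈ Set.Icc (0 : ℝ) (2 * π),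
      T ((cos θ • y + sin θ • z) ^ (2 * q)) = (2 * q).factorial := by
  refine eq_of_integral_eq two_pi_pos (continuous_map_pow_one T y z (2 * q)) continuous_const
    (fun θ _ => h θ) ?_
  have h2 := integral_circle_one T y z q
  rw [heq] at h2
  have h4 : 4 ^ q * (q.factorial : ℝ) ^ 2 ≠ 0 := by positivity
  apply mul_left_cancel₀ h4
  rw [h2, intervalIntegral.integral_const, sub_zero, smul_eq_mul]
  ring

theorem integral_sin_mul_const (C : ℝ) : ∫ φ in (0)..π, sin φ * C = 2 * C := by
  rw [intervalIntegral.integral_mul_const, integral_sin, cos_zero, cos_pi]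
  norm_num

theorem continuous_meridian (x y : R) (n : ℕ) :
    Continuous fun φ : ℝ => sin φ * T ((cos φ • x + sin φ • y) ^ n) :=
  continuous_sin.mul (continuous_map_pow_one T x y n)

theorem integral_meridian_le {x y : R} {n : ℕ} {C : ℝ}
    (h : ∀ φ : ℝ, T ((cos φ • x + sin φ • y) ^ n) ≤ C) :
    ∫ φ in (0)..π, sin φ * T ((cos φ • x + sin φ • y) ^ n) ≤ 2 * C := by
  rw [← integral_sin_mul_const C]
  refine intervalIntegral.integral_mono_on pi_pos.le
    ((continuous_meridian T x y n).intervalIntegrable _ _)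
    ((continuous_sin.mul continuous_const).intervalIntegrable _ _) fun φ hφ => ?_
  exact mul_le_mul_of_nonneg_left (h φ) (sin_nonneg_of_mem_Icc hφ)

theorem map_sphere_le {x y z : R} {p : ℕ}
    (h : ∀ θ φ : ℝ, T ((cos φ • x + sin φ • (cos θ • y + sin θ • z)) ^ (2 * p)) ≤
      (2 * p).factorial) :
    T ((x ^ 2 + y ^ 2 + z ^ 2) ^ p) ≤ (2 * p + 1).factorial := by
  have h1 := integral_le_mul_of_le two_pi_pos (continuous_integral_meridian T x y z p)
    fun θ _ => integral_meridian_le T (h θ)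
  have h2 := integral_sphere T x y z p
  have h3 := mul_le_mul_of_nonneg_left h1 (by positivity : (0 : ℝ) ≤ 2 * p + 1)
  rw [h2] at h3
  have h4 : 0 < 4 * π := by positivity
  refine le_of_mul_le_mul_left (h3.trans_eq ?_) h4
  rw [Nat.factorial_succ]
  push_cast
  ring

theorem map_sphere_eq {x y z : R} {p : ℕ}
    (h : ∀ θ φ : ℝ, T ((cos φ • x + sin φ • (cos θ • y + sin θ • z)) ^ (2 * p)) =
      (2 * p).factorial) :
    T ((x ^ 2 + y ^ 2 + z ^ 2) ^ p) = (2 * p + 1).factorial := by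
  have h2 := integral_sphere T x y z p
  simp only [h, integral_sin_mul_const, intervalIntegral.integral_const, sub_zero,
    smul_eq_mul] at h2
  have h4 : 4 * π ≠ 0 := by positivity
  apply mul_left_cancel₀ h4
  rw [← h2, Nat.factorial_succ]
  push_cast
  ring

/-- Equality of the means forces, by continuity, equality of the integral along each meridian, and
then pointwise equality after weighting by sin φ. At φ = π/2 the weight is 1, and only the circle
through y and z remains. -/
theorem equator_eq_of_map_eq {x y z : R} {p : ℕ}
    (h : ∀ θ φ : ℝ, T ((cos φ • x + sin φ • (cos θ • y + sin θ • z)) ^ (2 * p)) ≤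
      (2 * p).factorial)
    (heq : T ((x ^ 2 + y ^ 2 + z ^ 2) ^ p) = (2 * p + 1).factorial) :
    ∀ θ ∈ Set.Icc (0 : ℝ) (2 * π),
      T ((cos θ • y + sin θ • z) ^ (2 * p)) = (2 * p).factorial := by
  have h1 := eq_of_integral_eq two_pi_pos (continuous_integral_meridian T x y z p)
    (continuous_const (y := 2 * ((2 * p).factorial : ℝ)))
    (fun θ _ => integral_meridian_le T (h θ)) (by
      have h2 := integral_sphere T x y z p
      rw [heq, Nat.factorial_succ] at h2
      have h4 : (2 * p + 1 : ℝ) ≠ 0 := by positivity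
      apply mul_left_cancel₀ h4
      rw [h2, intervalIntegral.integral_const, sub_zero, smul_eq_mul]
      push_cast
      ring)
  intro θ hθ
  have h2 := eq_of_integral_eq pi_pos (continuous_meridian T x (cos θ • y + sin θ • z) (2 * p))
    (continuous_sin.mul (continuous_const (y := ((2 * p).factorial : ℝ))))
    (fun φ hφ => mul_le_mul_of_nonneg_left (h θ φ) (sin_nonneg_of_mem_Icc hφ))
    ((h1 θ hθ).trans (integral_sin_mul_const _).symm) (π / 2)
    ⟨by positivity, by linarith [pi_pos]⟩
  simpa using h2

end Average

/-! ### Bivectors in the commutative center -/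

section Omega

variable {F : Type*} [NormedAddCommGroup F] [InnerProductSpace ℝ F]

/-- The bivector of the `2`-form `⟪A v, w⟫` and a finite family of vectors, as a central element. -/
noncomputable def omega (A : F →ₗ[ℝ] F) {n : ℕ} (e : Fin n → F) :
    Subalgebra.center ℝ (ExteriorAlgebra ℝ (Fin n → ℝ)) :=
  ⟨bivector (Pi.basisFun ℝ (Fin n)) (fun i j => inner ℝ (A (e i)) (e j)), bivector_mem_center _ _⟩

/-- `topCoeff` on the center of the exterior algebra. -/
noncomputable def topCenter (n : ℕ) :
    Subalgebra.center ℝ (ExteriorAlgebra ℝ (Fin n → ℝ)) →ₗ[ℝ] ℝ :=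
  topCoeff n ∘ₗ (Subalgebra.center ℝ (ExteriorAlgebra ℝ (Fin n → ℝ))).val.toLinearMap

theorem topCenter_omega_pow (A : F →ₗ[ℝ] F) (m : ℕ) {n : ℕ} (e : Fin n → F) :
    topCenter n (omega A e ^ m) = pfaff A m e := rfl

theorem omega_add (A B : F →ₗ[ℝ] F) {n : ℕ} (e : Fin n → F) :
    omega (A + B) e = omega A e + omega B e := by
  apply Subtype.ext
  simp only [omega, bivector, AddMemClass.mk_add_mk, ← smul_add, ← Finset.sum_add_distrib,
    ← add_smul, LinearMap.add_apply, inner_add_left]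

theorem omega_smul (c : ℝ) (A : F →ₗ[ℝ] F) {n : ℕ} (e : Fin n → F) :
    omega (c • A) e = c • omega A e := by
  apply Subtype.ext
  rw [SetLike.val_smul]
  simp only [omega, bivector, Finset.smul_sum, LinearMap.smul_apply, real_inner_smul_left, mul_smul]
  simp only [smul_comm c]

theorem pfaff_comp_perm {A : F →ₗ[ℝ] F} (hA : ∀ v, inner ℝ (A v) v = 0) (hn : ∀ v, ‖A v‖ ≤ ‖v‖)
    {m n : ℕ} (hnm : n = 2 * m) (e : Fin n → F) (σ : Equiv.Perm (Fin n)) :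
    pfaff A m (e ∘ σ) = (Equiv.Perm.sign σ : ℝ) * pfaff A m e := by
  subst hnm
  rw [pfaff_eq hA hn, pfaff_eq hA hn]
  have := (wedgePow (skewForm A hA hn) m).toAlternatingMap.map_perm e σ
  rcases Int.units_eq_one_or (Equiv.Perm.sign σ) with h | h <;> rw [h] at this ⊢ <;>
    simpa using this

end Omega

/-- A continuous function on the line taking only the values ±C cannot jump. It will show that the
sign of ω_u^{2p} on a quaternionic subspace does not depend on u. -/
theorem eq_of_continuous_of_abs_eq {f : ℝ → ℝ} (hf : Continuous f) {C : ℝ} (hC : C ≠ 0)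
    (h : ∀ t, |f t| = C) (s t : ℝ) : f s = f t := by
  refine isPreconnected_univ.eq_of_sq_eq (S := Set.univ) (g := fun _ => f t) hf.continuousOn
    continuousOn_const (fun x _ => ?_) (fun _ => ?_) (Set.mem_univ t) rfl (Set.mem_univ s)
  · simp only [Pi.pow_apply]
    rw [← sq_abs, h, ← sq_abs (f t), h]
  · intro h0
    have := h t
    rw [h0, abs_zero] at this
    exact hC this.symm

/-! ### Quaternionic linear algebra -/

section Hyperhermitian

variable {F : Type*} [NormedAddCommGroup F] [InnerProductSpace ℝ F]

section Combination

variable (I J K : F →ₗ[ℝ] F)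

open Real

theorem topCenter_combination (a b c : ℝ) (m : ℕ) {n : ℕ} (e : Fin n → F) :
    topCenter n ((a • omega I e + b • omega J e + c • omega K e) ^ m) =
      pfaff (a • I + b • J + c • K) m e := by
  rw [← topCenter_omega_pow, omega_add, omega_add, omega_smul, omega_smul, omega_smul]

theorem topCenter_sphere (θ φ : ℝ) (m : ℕ) {n : ℕ} (e : Fin n → F) :
    topCenter n ((cos φ • omega I e + sin φ • (cos θ • omega J e + sin θ • omega K e)) ^ m) =
      pfaff (cos φ • I + (sin φ * cos θ) • J + (sin φ * sin θ) • K) m e := by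
  rw [← topCenter_combination, smul_add, smul_smul, smul_smul, add_assoc]

theorem topCenter_circle (θ : ℝ) (m : ℕ) {n : ℕ} (e : Fin n → F) :
    topCenter n ((cos θ • omega J e + sin θ • omega K e) ^ m) =
      pfaff ((0 : ℝ) • I + cos θ • J + sin θ • K) m e := by
  rw [← topCenter_combination, zero_smul, zero_add]

theorem sphere_sq (θ φ : ℝ) : cos φ ^ 2 + (sin φ * cos θ) ^ 2 + (sin φ * sin θ) ^ 2 = 1 := by
  rw [mul_pow, mul_pow, add_assoc, ← mul_add, cos_sq_add_sin_sq, mul_one, cos_sq_add_sin_sq]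

theorem circle_sq (θ : ℝ) : (0 : ℝ) ^ 2 + cos θ ^ 2 + sin θ ^ 2 = 1 := by
  rw [zero_pow two_ne_zero, zero_add, cos_sq_add_sin_sq]

end Combination

/-- A triple of orthogonal operators satisfying the quaternionic relations. -/
structure IsHyperhermitian (I J K : F →ₗ[ℝ] F) : Prop where
  I_I (v : F) : I (I v) = -v
  J_J (v : F) : J (J v) = -v
  I_J (v : F) : I (J v) = K v
  J_I (v : F) : J (I v) = -K v
  inner_I (v w : F) : inner ℝ (I v) (I w) = inner ℝ v w
  inner_J (v w : F) : inner ℝ (J v) (J w) = inner ℝ v w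

namespace IsHyperhermitian

variable {I J K : F →ₗ[ℝ] F} (h : IsHyperhermitian I J K)
include h

theorem I_K (v : F) : I (K v) = -J v := by rw [← h.I_J, h.I_I]

theorem K_J (v : F) : K (J v) = -I v := by rw [← h.I_J, h.J_J, map_neg]

theorem J_K (v : F) : J (K v) = I v := by rw [← h.I_J, h.J_I, h.K_J, neg_neg]

theorem K_I (v : F) : K (I v) = J v := by rw [← h.I_J, h.J_I, map_neg, h.I_K, neg_neg]

theorem K_K (v : F) : K (K v) = -v := by rw [← h.I_J (K v), h.J_K, h.I_I]

theorem inner_K (v w : F) : inner ℝ (K v) (K w) = inner ℝ v w := by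
  rw [← h.I_J, ← h.I_J, h.inner_I, h.inner_J]

theorem inner_I_left (v w : F) : inner ℝ (I v) w = - inner ℝ v (I w) := by
  rw [← h.inner_I, h.I_I, inner_neg_left]

theorem inner_J_left (v w : F) : inner ℝ (J v) w = - inner ℝ v (J w) := by
  rw [← h.inner_J, h.J_J, inner_neg_left]

theorem inner_K_left (v w : F) : inner ℝ (K v) w = - inner ℝ v (K w) := by
  rw [← h.inner_K, h.K_K, inner_neg_left]

theorem inner_combination_left (a b c : ℝ) (v w : F) :
    inner ℝ ((a • I + b • J + c • K) v) w = - inner ℝ v ((a • I + b • J + c • K) w) := by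
  simp only [LinearMap.add_apply, LinearMap.smul_apply, inner_add_left, inner_add_right,
    real_inner_smul_left, real_inner_smul_right, h.inner_I_left, h.inner_J_left, h.inner_K_left]
  ring

theorem inner_combination_self (a b c : ℝ) (v : F) :
    inner ℝ ((a • I + b • J + c • K) v) v = 0 := by
  have := h.inner_combination_left a b c v v
  rw [real_inner_comm v] at this
  rw [real_inner_comm]
  linarith

/-- A unit imaginary quaternion squares to -1 because the mixed terms cancel, and a skew operator
with square -1 is an isometry. -/
theorem inner_combination {a b c : ℝ} (habc : a ^ 2 + b ^ 2 + c ^ 2 = 1) (v w : F) :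
    inner ℝ ((a • I + b • J + c • K) v) ((a • I + b • J + c • K) w) = inner ℝ v w := by
  rw [h.inner_combination_left]
  have : (a • I + b • J + c • K) ((a • I + b • J + c • K) w) = -w := by
    have h1 : (a • I + b • J + c • K) ((a • I + b • J + c • K) w) =
        -((a ^ 2 + b ^ 2 + c ^ 2) • w) := by
      simp only [LinearMap.add_apply, LinearMap.smul_apply, map_add, map_smul, h.I_I, h.I_J, h.I_K,
        h.J_I, h.J_J, h.J_K, h.K_I, h.K_J, h.K_K]
      module
    rw [h1, habc, one_smul]
  rw [this, inner_neg_right, neg_neg]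

theorem norm_combination {a b c : ℝ} (habc : a ^ 2 + b ^ 2 + c ^ 2 = 1) (v : F) :
    ‖(a • I + b • J + c • K) v‖ ≤ ‖v‖ := by
  rw [norm_eq_sqrt_real_inner, h.inner_combination habc, ← norm_eq_sqrt_real_inner]

open Real

variable {p : ℕ} {e : Fin (4 * p) → F}

theorem abs_sphere_le (he : Orthonormal ℝ e) (θ φ : ℝ) :
    |topCenter _ ((cos φ • omega I e + sin φ • (cos θ • omega J e + sin θ • omega K e)) ^ (2 * p))|
      ≤ (2 * p).factorial := by
  rw [topCenter_sphere]
  exact abs_pfaff_le (h.inner_combination_self _ _ _) (h.norm_combination (sphere_sq θ φ)) _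
    (by ring) he

theorem abs_circle_le (he : Orthonormal ℝ e) (θ : ℝ) :
    |topCenter _ ((cos θ • omega J e + sin θ • omega K e) ^ (2 * p))| ≤ (2 * p).factorial := by
  rw [topCenter_circle (I := I)]
  exact abs_pfaff_le (h.inner_combination_self _ _ _) (h.norm_combination (circle_sq θ)) _
    (by ring) he

theorem abs_theta_le (he : Orthonormal ℝ e) :
    |topCenter _ ((omega I e ^ 2 + omega J e ^ 2 + omega K e ^ 2) ^ p)| ≤
      (2 * p + 1).factorial := by
  refine abs_le'.mpr ⟨map_sphere_le _ fun θ φ => (abs_le'.mp (h.abs_sphere_le he θ φ)).1, ?_⟩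
  -- The averaging bound holds for any linear functional, so the negated one gives the lower bound.
  exact map_sphere_le (-topCenter _) fun θ φ => (abs_le'.mp (h.abs_sphere_le he θ φ)).2

theorem abs_xi_le (he : Orthonormal ℝ e) :
    |topCenter _ ((omega J e ^ 2 + omega K e ^ 2) ^ p)| ≤ (p.factorial : ℝ) ^ 2 * 4 ^ p := by
  refine abs_le'.mpr ⟨map_circle_le _ fun θ => (abs_le'.mp (h.abs_circle_le he θ)).1, ?_⟩
  exact map_circle_le (-topCenter _) fun θ => (abs_le'.mp (h.abs_circle_le he θ)).2

/-- The equality case of Wirtinger at θ = 0 and θ = π/2 gives invariance under J and K, and I = JK.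
-/
theorem invariant_of_circle_eq (he : Orthonormal ℝ e)
    (heq : ∀ θ ∈ Set.Icc (0 : ℝ) (2 * π),
      topCenter _ ((cos θ • omega J e + sin θ • omega K e) ^ (2 * p)) = (2 * p).factorial) :
    ∀ v ∈ Submodule.span ℝ (Set.range e), I v ∈ Submodule.span ℝ (Set.range e) ∧
      J v ∈ Submodule.span ℝ (Set.range e) ∧ K v ∈ Submodule.span ℝ (Set.range e) := by
  have key : ∀ θ ∈ Set.Icc (0 : ℝ) (2 * π), ∀ v ∈ Submodule.span ℝ (Set.range e),
      ((0 : ℝ) • I + cos θ • J + sin θ • K) v ∈ Submodule.span ℝ (Set.range e) := by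
    intro θ hθ v hv
    refine map_mem_span_of_abs_pfaff_eq (h.inner_combination_self _ _ _)
      (h.norm_combination (circle_sq θ)) (2 * p) (by ring) he ?_ hv
    rw [← topCenter_circle, heq θ hθ, Nat.abs_cast]
  have hJ : ∀ v ∈ Submodule.span ℝ (Set.range e), J v ∈ Submodule.span ℝ (Set.range e) := by
    intro v hv
    simpa using key 0 ⟨le_rfl, two_pi_pos.le⟩ v hv
  have hK : ∀ v ∈ Submodule.span ℝ (Set.range e), K v ∈ Submodule.span ℝ (Set.range e) := by
    intro v hv
    simpa using key (π / 2) ⟨by positivity, by linarith [pi_pos]⟩ v hv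
  exact fun v hv => ⟨h.J_K v ▸ hJ _ (hK v hv), hJ v hv, hK v hv⟩

theorem invariant_of_xi_eq (he : Orthonormal ℝ e)
    (heq : topCenter _ ((omega J e ^ 2 + omega K e ^ 2) ^ p) = (p.factorial : ℝ) ^ 2 * 4 ^ p) :
    ∀ v ∈ Submodule.span ℝ (Set.range e), I v ∈ Submodule.span ℝ (Set.range e) ∧
      J v ∈ Submodule.span ℝ (Set.range e) ∧ K v ∈ Submodule.span ℝ (Set.range e) :=
  h.invariant_of_circle_eq he
    (circle_eq_of_map_eq _ (fun θ => (abs_le'.mp (h.abs_circle_le he θ)).1) heq)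

theorem invariant_of_theta_eq (he : Orthonormal ℝ e)
    (heq : topCenter _ ((omega I e ^ 2 + omega J e ^ 2 + omega K e ^ 2) ^ p) =
      (2 * p + 1).factorial) :
    ∀ v ∈ Submodule.span ℝ (Set.range e), I v ∈ Submodule.span ℝ (Set.range e) ∧
      J v ∈ Submodule.span ℝ (Set.range e) ∧ K v ∈ Submodule.span ℝ (Set.range e) :=
  h.invariant_of_circle_eq he
    (equator_eq_of_map_eq _ (fun θ φ => (abs_le'.mp (h.abs_sphere_le he θ φ)).1) heq)

theorem exists_pos_orthonormal {W : Submodule ℝ F} (hW : Module.finrank ℝ W = 4 * p)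
    [FiniteDimensional ℝ W] (hI : ∀ v ∈ W, I v ∈ W) :
    ∃ e : Fin (4 * p) → F, Orthonormal ℝ e ∧ Submodule.span ℝ (Set.range e) = W ∧
      pfaff I (2 * p) e = (2 * p).factorial := by
  obtain ⟨e, he, hs⟩ := exists_orthonormal_span_eq W hW
  have hI0 : ∀ v, inner ℝ (I v) v = 0 := by simpa using h.inner_combination_self 1 0 0
  have hIn : ∀ v, ‖I v‖ ≤ ‖v‖ := by
    simpa using h.norm_combination (a := 1) (b := 0) (c := 0) (by norm_num)
  have habs := abs_pfaff_eq_factorial hI0 h.inner_I (2 * p) (by ring) he (by rw [hs]; exact hI)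
  rcases (abs_eq (Nat.cast_nonneg _)).mp habs with h1 | h1
  · exact ⟨e, he, hs, h1⟩
  -- A negative sign is corrected by swapping two basis vectors. For p = 0 there is nothing to swap,
  -- but the empty Pfaffian is 1 and the negative case is contradictory.
  · rcases Nat.eq_zero_or_pos p with rfl | hp
    · rw [← topCenter_omega_pow] at h1
      have h2 := topCoeff_ιMulti 0 (Pi.basisFun ℝ (Fin 0))
      rw [ExteriorAlgebra.ιMulti_zero_apply, Module.Basis.det_self] at h2
      have h3 : topCenter (4 * 0) (omega I e ^ (2 * 0)) = 1 := h2
      rw [h3] at h1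
      norm_num at h1
    · let i₀ : Fin (4 * p) := ⟨0, by omega⟩
      let i₁ : Fin (4 * p) := ⟨1, by omega⟩
      have hne : i₀ ≠ i₁ := by simp [i₀, i₁]
      refine ⟨e ∘ Equiv.swap i₀ i₁, he.comp _ (Equiv.injective _), ?_, ?_⟩
      · rw [EquivLike.range_comp, hs]
      · rw [pfaff_comp_perm hI0 hIn (by ring), h1, Equiv.Perm.sign_swap hne]
        simp

/-- On a suitably oriented orthonormal basis of a quaternionic subspace both forms attain their
bounds. -/
theorem exists_orthonormal_eq {W : Submodule ℝ F} (hW : Module.finrank ℝ W = 4 * p)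
    [FiniteDimensional ℝ W] (hI : ∀ v ∈ W, I v ∈ W) (hJ : ∀ v ∈ W, J v ∈ W)
    (hK : ∀ v ∈ W, K v ∈ W) :
    ∃ e : Fin (4 * p) → F, Orthonormal ℝ e ∧ Submodule.span ℝ (Set.range e) = W ∧
      topCenter _ ((omega I e ^ 2 + omega J e ^ 2 + omega K e ^ 2) ^ p) = (2 * p + 1).factorial ∧
      topCenter _ ((omega J e ^ 2 + omega K e ^ 2) ^ p) = (p.factorial : ℝ) ^ 2 * 4 ^ p := by
  obtain ⟨e, he, hs, hpos⟩ := h.exists_pos_orthonormal hW hI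
  have hinv : ∀ a b c : ℝ, ∀ v ∈ Submodule.span ℝ (Set.range e),
      (a • I + b • J + c • K) v ∈ Submodule.span ℝ (Set.range e) := by
    rw [hs]
    intro a b c v hv
    exact add_mem (add_mem (W.smul_mem _ (hI v hv)) (W.smul_mem _ (hJ v hv)))
      (W.smul_mem _ (hK v hv))
  have habs : ∀ θ φ : ℝ, |topCenter _ ((cos φ • omega I e +
      sin φ • (cos θ • omega J e + sin θ • omega K e)) ^ (2 * p))| = (2 * p).factorial := by
    intro θ φ
    rw [topCenter_sphere]
    exact abs_pfaff_eq_factorial (h.inner_combination_self _ _ _)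
      (h.inner_combination (sphere_sq θ φ)) _ (by ring) he (hinv _ _ _)
  -- Every meridian passes through the pole φ = 0, where the structure is I and the orientation was
  -- chosen to make the value positive; continuity in φ carries the sign along the meridian.
  have hall : ∀ θ φ : ℝ, topCenter _ ((cos φ • omega I e +
      sin φ • (cos θ • omega J e + sin θ • omega K e)) ^ (2 * p)) = (2 * p).factorial := by
    intro θ φ
    rw [eq_of_continuous_of_abs_eq (continuous_map_pow_one _ _ _ _) (by positivity) (habs θ) φ 0,
      cos_zero, sin_zero, one_smul, zero_smul, add_zero, topCenter_omega_pow, hpos]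
  refine ⟨e, he, hs, map_sphere_eq _ hall, map_circle_eq _ fun θ => ?_⟩
  simpa using hall θ (π / 2)

/-- As long as the orthogonal complement is nonzero, W can be enlarged by the quaternionic line v,
Iv, Jv, Kv of a vector v in it. This supplies the subspaces on which the comass is attained. -/
theorem exists_quaternionic_subspace [FiniteDimensional ℝ F] (p : ℕ)
    (hp : 4 * p ≤ Module.finrank ℝ F) :
    ∃ W : Submodule ℝ F, (∀ v ∈ W, I v ∈ W) ∧ (∀ v ∈ W, J v ∈ W) ∧ (∀ v ∈ W, K v ∈ W) ∧
      Module.finrank ℝ W = 4 * p := by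
  induction p with
  | zero => exact ⟨⊥, by simp, by simp, by simp, by simp⟩
  | succ p ih =>
    obtain ⟨W, hI, hJ, hK, hW⟩ := ih (by omega)
    have hne : Wᗮ ≠ ⊥ := by
      intro hbot
      have := W.finrank_add_finrank_orthogonal
      rw [hbot, finrank_bot] at this
      omega
    obtain ⟨v, hv, hv0⟩ := Submodule.exists_mem_ne_zero_of_ne_bot hne
    have hv' := fun w hw => (Submodule.mem_orthogonal' W v).mp hv w hw
    have hvv : inner ℝ v v ≠ 0 := inner_self_ne_zero.mpr hv0
    have hIv : inner ℝ v (I v) = 0 := by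
      have := h.inner_I_left v v; rw [real_inner_comm] at this; linarith
    have hJv : inner ℝ v (J v) = 0 := by
      have := h.inner_J_left v v; rw [real_inner_comm] at this; linarith
    have hKv : inner ℝ v (K v) = 0 := by
      have := h.inner_K_left v v; rw [real_inner_comm] at this; linarith
    let u : Fin 4 → F := ![v, I v, J v, K v]
    have hu : LinearIndependent ℝ u := by
      refine linearIndependent_of_ne_zero_of_inner_eq_zero (fun i => ?_) (fun i j hij => ?_)
      · rw [← norm_ne_zero_iff]
        have h1 : ∀ w : F, inner ℝ w w = inner ℝ v v → ‖w‖ ≠ 0 := fun w hw => by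
          rw [norm_ne_zero_iff, ← inner_self_ne_zero (𝕜 := ℝ), hw]; exact hvv
        apply h1
        fin_cases i
        exacts [rfl, h.inner_I v v, h.inner_J v v, h.inner_K v v]
      · fin_cases i <;> fin_cases j <;>
          first
          | exact absurd rfl hij
          | simp [u, h.inner_I_left, h.inner_J_left, h.inner_K_left, h.I_J, h.I_K, h.J_I,
              h.J_K, h.K_I, h.K_J, hIv, hJv, hKv]
    let U := Submodule.span ℝ (Set.range u)
    have hUinv : ∀ A : F →ₗ[ℝ] F, (∀ i, A (u i) ∈ U) → ∀ x ∈ U, A x ∈ U := by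
      intro A hA x hx
      have : U ≤ U.comap A := Submodule.span_le.mpr (by rintro _ ⟨i, rfl⟩; exact hA i)
      exact this hx
    have hmem : ∀ i, u i ∈ U := fun i => Submodule.subset_span (Set.mem_range_self i)
    have h0 : v ∈ U := hmem 0
    have h1 : I v ∈ U := hmem 1
    have h2 : J v ∈ U := hmem 2
    have h3 : K v ∈ U := hmem 3
    have hIU := hUinv I fun i => by
      fin_cases i <;> simp [u, h.I_I, h.I_J, h.I_K, h0, h1, h2, h3]
    have hJU := hUinv J fun i => by
      fin_cases i <;> simp [u, h.J_I, h.J_J, h.J_K, h0, h1, h2, h3]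
    have hKU := hUinv K fun i => by
      fin_cases i <;> simp [u, h.K_I, h.K_J, h.K_K, h0, h1, h2, h3]
    have hsup : ∀ A : F →ₗ[ℝ] F, (∀ x ∈ W, A x ∈ W) → (∀ x ∈ U, A x ∈ U) →
        ∀ x ∈ W ⊔ U, A x ∈ W ⊔ U := by
      intro A hAW hAU x hx
      obtain ⟨y, hy, z, hz, rfl⟩ := Submodule.mem_sup.mp hx
      rw [map_add]
      exact Submodule.add_mem_sup (hAW y hy) (hAU z hz)
    -- Skewness moves I, J, K from v onto elements of W, which stay in W, and v is orthogonal to W.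
    have hUW : U ≤ Wᗮ := by
      refine Submodule.span_le.mpr ?_
      rintro _ ⟨i, rfl⟩
      refine (Submodule.mem_orthogonal' W _).mpr fun w hw => ?_
      fin_cases i <;> simp [u, h.inner_I_left, h.inner_J_left, h.inner_K_left, hv', hw, hI, hJ, hK]
    have hdisj : Disjoint W U := W.orthogonal_disjoint.mono_right hUW
    refine ⟨W ⊔ U, hsup I hI hIU, hsup J hJ hJU, hsup K hK hKU, ?_⟩
    have hU : Module.finrank ℝ U = 4 := by
      rw [finrank_span_eq_card hu, Fintype.card_fin]
    have := Submodule.finrank_sup_add_finrank_inf_eq W U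
    rw [hdisj.eq_bot, finrank_bot, hW, hU] at this
    omega

end IsHyperhermitian

end Hyperhermitian

/-! ### Smoothness and closedness of wedge products -/

section Wedge

variable {V : Type*} [AddCommGroup V] [Module ℝ V] [TopologicalSpace V]
variable {V' : Type*} [AddCommGroup V'] [Module ℝ V'] [TopologicalSpace V']

theorem factorial_mul_wedge_apply {a b : ℕ} (α : V [⋀^Fin a]→L[ℝ] ℝ) (β : V [⋀^Fin b]→L[ℝ] ℝ)
    (v : Fin (a + b) → V) : (a.factorial * b.factorial : ℝ) * wedge α β v =
      ∑ σ : Equiv.Perm (Fin a ⊕ Fin b), (Equiv.Perm.sign σ : ℝ) *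
        (α (fun i => v (finSumFinEquiv (σ (Sum.inl i)))) *
          β (fun i => v (finSumFinEquiv (σ (Sum.inr i))))) :=
  factorial_mul_wedgeAlt_apply _ _ v

theorem wedge_ext {a b : ℕ} {η η' : V [⋀^Fin (a + b)]→L[ℝ] ℝ}
    (h : ∀ v, (a.factorial * b.factorial : ℝ) * η v = (a.factorial * b.factorial : ℝ) * η' v) :
    η = η' :=
  ContinuousAlternatingMap.ext fun v =>
    mul_left_cancel₀ (by positivity : (a.factorial * b.factorial : ℝ) ≠ 0) (h v)

theorem wedge_compContinuousLinearMap {a b : ℕ} (α : V [⋀^Fin a]→L[ℝ] ℝ)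
    (β : V [⋀^Fin b]→L[ℝ] ℝ) (L : V' →L[ℝ] V) :
    (wedge α β).compContinuousLinearMap L =
      wedge (α.compContinuousLinearMap L) (β.compContinuousLinearMap L) := by
  refine wedge_ext fun v => ?_
  rw [ContinuousAlternatingMap.compContinuousLinearMap_apply, factorial_mul_wedge_apply,
    factorial_mul_wedge_apply]
  rfl

end Wedge

section Normed

variable {V : Type*} [NormedAddCommGroup V] [NormedSpace ℝ V] {a b : ℕ}

/-- A crude bound, counting all permutations; it serves only to make the wedge product a continuous
bilinear map. -/
theorem norm_wedge_le (α : V [⋀^Fin a]→L[ℝ] ℝ) (β : V [⋀^Fin b]→L[ℝ] ℝ) :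
    ‖wedge α β‖ ≤ (Fintype.card (Equiv.Perm (Fin a ⊕ Fin b)) : ℝ) * ‖α‖ * ‖β‖ := by
  refine ContinuousAlternatingMap.opNorm_le_bound _ (by positivity) fun v => ?_
  have h1 : ‖wedge α β v‖ ≤ ‖(a.factorial * b.factorial : ℝ) * wedge α β v‖ := by
    rw [norm_mul]
    refine le_mul_of_one_le_left (norm_nonneg _) ?_
    rw [Real.norm_of_nonneg (by positivity)]
    exact one_le_mul_of_one_le_of_one_le (by exact_mod_cast Nat.factorial_pos a)
      (by exact_mod_cast Nat.factorial_pos b)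
  refine h1.trans ?_
  rw [factorial_mul_wedge_apply]
  refine (norm_sum_le _ _).trans
    ((Finset.sum_le_card_nsmul _ _ (‖α‖ * ‖β‖ * ∏ i, ‖v i‖) ?_).trans ?_)
  · intro σ _
    have hs : ‖((Equiv.Perm.sign σ : ℤ) : ℝ)‖ = 1 := by
      rcases Int.units_eq_one_or (Equiv.Perm.sign σ) with h | h <;> simp [h]
    have hp : ∏ i, ‖v i‖ = (∏ i, ‖v (finSumFinEquiv (σ (Sum.inl i)))‖) *
        ∏ i, ‖v (finSumFinEquiv (σ (Sum.inr i)))‖ := by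
      rw [← Equiv.prod_comp finSumFinEquiv, ← Equiv.prod_comp σ, Fintype.prod_sum_type]
    rw [norm_mul, hs, one_mul, norm_mul, hp]
    refine (mul_le_mul (α.le_opNorm _) (β.le_opNorm _) (norm_nonneg _) (by positivity)).trans_eq ?_
    ring
  · rw [Finset.card_univ, nsmul_eq_mul]
    apply le_of_eq
    ring

variable (V a b) in
/-- The wedge product as a continuous bilinear map. -/
noncomputable def wedgeCLM :
    (V [⋀^Fin a]→L[ℝ] ℝ) →L[ℝ] (V [⋀^Fin b]→L[ℝ] ℝ) →L[ℝ] (V [⋀^Fin (a + b)]→L[ℝ] ℝ) :=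
  LinearMap.mkContinuous₂
    (LinearMap.mk₂ ℝ wedge
      (fun α α' β => wedge_ext fun v => by
        simp only [ContinuousAlternatingMap.add_apply, mul_add, factorial_mul_wedge_apply,
          ← Finset.sum_add_distrib, add_mul])
      (fun c α β => wedge_ext fun v => by
        rw [ContinuousAlternatingMap.smul_apply, smul_eq_mul, mul_left_comm,
          factorial_mul_wedge_apply, factorial_mul_wedge_apply, Finset.mul_sum]
        refine Finset.sum_congr rfl fun σ _ => ?_
        rw [ContinuousAlternatingMap.smul_apply, smul_eq_mul]
        ring)
      (fun α β β' => wedge_ext fun v => by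
        simp only [ContinuousAlternatingMap.add_apply, mul_add, factorial_mul_wedge_apply,
          ← Finset.sum_add_distrib])
      (fun c α β => wedge_ext fun v => by
        rw [ContinuousAlternatingMap.smul_apply, smul_eq_mul, mul_left_comm,
          factorial_mul_wedge_apply, factorial_mul_wedge_apply, Finset.mul_sum]
        refine Finset.sum_congr rfl fun σ _ => ?_
        rw [ContinuousAlternatingMap.smul_apply, smul_eq_mul]
        ring))
    (Fintype.card (Equiv.Perm (Fin a ⊕ Fin b))) norm_wedge_le

theorem wedgeCLM_apply (α : V [⋀^Fin a]→L[ℝ] ℝ) (β : V [⋀^Fin b]→L[ℝ] ℝ) :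
    wedgeCLM V a b α β = wedge α β := rfl

theorem contDiffOn_wedge {f : V → V [⋀^Fin a]→L[ℝ] ℝ} {g : V → V [⋀^Fin b]→L[ℝ] ℝ} {s : Set V}
    (hf : ContDiffOn ℝ ∞ f s) (hg : ContDiffOn ℝ ∞ g s) :
    ContDiffOn ℝ ∞ (fun y => wedge (f y) (g y)) s := by
  have h1 : ContDiff ℝ ∞ (wedgeCLM V a b) :=
    ContinuousLinearMap.contDiff (𝕜 := ℝ) (E := V [⋀^Fin a]→L[ℝ] ℝ)
      (F := (V [⋀^Fin b]→L[ℝ] ℝ) →L[ℝ] V [⋀^Fin (a + b)]→L[ℝ] ℝ) (wedgeCLM V a b)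
  have h2 : ContDiffOn ℝ ∞ (fun y => wedgeCLM V a b (f y)) s := h1.comp_contDiffOn hf
  have h3 : ContDiffOn ℝ ∞ (fun y => wedgeCLM V a b (f y) (g y)) s := ContDiffOn.clm_apply h2 hg
  exact h3

theorem toExt_extDeriv {ι M : Type*} [Fintype ι] [AddCommGroup M] [Module ℝ M]
    (f : V → V [⋀^Fin a]→L[ℝ] ℝ) (x : V) (e : ι → V) (ε : ι → M) :
    toExt e ε (extDeriv f x).toAlternatingMap =
      ∑ i, ExteriorAlgebra.ι ℝ (ε i) * toExt e ε (fderiv ℝ f x (e i)).toAlternatingMap := by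
  rw [extDeriv, ContinuousAlternatingMap.toAlternatingMap_alternatizeUncurryFin,
    toExt_alternatizeUncurryFin]
  rfl

/-- The wedge product of closed forms, the first of them of even degree, is closed. -/
theorem extDeriv_wedge_eq_zero (ha : Even a) {f : V → V [⋀^Fin a]→L[ℝ] ℝ}
    {g : V → V [⋀^Fin b]→L[ℝ] ℝ} {x : V} (hf : DifferentiableAt ℝ f x)
    (hg : DifferentiableAt ℝ g x) (hf0 : extDeriv f x = 0) (hg0 : extDeriv g x = 0) :
    extDeriv (fun y => wedge (f y) (g y)) x = 0 := by
  have hd : ∀ v, fderiv ℝ (fun y => wedge (f y) (g y)) x v =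
      wedge (f x) (fderiv ℝ g x v) + wedge (fderiv ℝ f x v) (g x) := by
    intro v
    have := ((wedgeCLM V a b).hasFDerivAt_of_bilinear hf.hasFDerivAt hg.hasFDerivAt).fderiv
    simp only [wedgeCLM_apply] at this
    rw [this]
    rfl
  ext v
  have h1 := topCoeff_toExt v (extDeriv (fun y => wedge (f y) (g y)) x).toAlternatingMap
  have h2 : (extDeriv (fun y => wedge (f y) (g y)) x).toAlternatingMap v =
    extDeriv (fun y => wedge (f y) (g y)) x v := rfl
  rw [← h2, ← h1, toExt_extDeriv]
  set ε := ⇑(Pi.basisFun ℝ (Fin (a + b + 1))) with hε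
  have hf1 := toExt_extDeriv f x v ε
  have hg1 := toExt_extDeriv g x v ε
  have hz : ∀ k, toExt v ε (0 : V [⋀^Fin k]→L[ℝ] ℝ).toAlternatingMap = 0 := fun k => by
    simp [toExt]
  rw [hf0, hz] at hf1
  rw [hg0, hz] at hg1
  -- Since f(x) has even degree it commutes with ε_i. Summed over i, the two terms become f · dg and
  -- df · g, which both vanish.
  have hsplit : ∀ i, ExteriorAlgebra.ι ℝ (ε i) *
      toExt v ε (fderiv ℝ (fun y => wedge (f y) (g y)) x (v i)).toAlternatingMap =
      toExt v ε (f x).toAlternatingMap * (ExteriorAlgebra.ι ℝ (ε i) *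
        toExt v ε (fderiv ℝ g x (v i)).toAlternatingMap) +
      ExteriorAlgebra.ι ℝ (ε i) * toExt v ε (fderiv ℝ f x (v i)).toAlternatingMap *
        toExt v ε (g x).toAlternatingMap := by
    intro i
    have h3 : (fderiv ℝ (fun y => wedge (f y) (g y)) x (v i)).toAlternatingMap =
        wedgeAlt (f x).toAlternatingMap (fderiv ℝ g x (v i)).toAlternatingMap +
        wedgeAlt (fderiv ℝ f x (v i)).toAlternatingMap (g x).toAlternatingMap := by
      rw [hd]; rfl
    have h4 := toExt_mul_ι v ε (f x).toAlternatingMap (ε i)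
    rw [ha.neg_one_pow, one_smul] at h4
    rw [h3, toExt_add, toExt_wedgeAlt, toExt_wedgeAlt, mul_add, ← mul_assoc, ← mul_assoc,
      ← mul_assoc, h4]
  rw [Finset.sum_congr rfl fun i _ => hsplit i, Finset.sum_add_distrib, ← Finset.mul_sum,
    ← Finset.sum_mul, ← hf1, ← hg1, zero_mul, mul_zero, add_zero, map_zero]
  rfl

end Normed

section Closed

variable {E : Type*} [NormedAddCommGroup E] [NormedSpace ℝ E]
variable {M : Type*} [TopologicalSpace M] [ChartedSpace E M] {a b : ℕ}

theorem FormField.inChart_wedge (α : FormField E M a) (β : FormField E M b)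
    (e : OpenPartialHomeomorph M E) :
    (α.wedge β).inChart e = fun y => Calibration.wedge (α.inChart e y) (β.inChart e y) :=
  funext fun _ => wedge_compContinuousLinearMap _ _ _

theorem FormField.IsClosedForm.wedge {α : FormField E M a} {β : FormField E M b}
    (hα : α.IsClosedForm) (hβ : β.IsClosedForm) (ha : Even a) : (α.wedge β).IsClosedForm := by
  intro e he
  rw [FormField.inChart_wedge]
  obtain ⟨hα1, hα2⟩ := hα e he
  obtain ⟨hβ1, hβ2⟩ := hβ e he
  refine ⟨contDiffOn_wedge hα1 hβ1, fun y hy => ?_⟩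
  have hn := e.open_target.mem_nhds hy
  exact extDeriv_wedge_eq_zero ha ((hα1.differentiableOn (by simp)).differentiableAt hn)
    ((hβ1.differentiableOn (by simp)).differentiableAt hn) (hα2 y hy) (hβ2 y hy)

theorem FormField.IsClosedForm.add {α β : FormField E M a} (hα : α.IsClosedForm)
    (hβ : β.IsClosedForm) : (α + β).IsClosedForm := by
  intro e he
  have h : (α + β).inChart e = α.inChart e + β.inChart e := rfl
  obtain ⟨hα1, hα2⟩ := hα e he
  obtain ⟨hβ1, hβ2⟩ := hβ e he
  rw [h]
  refine ⟨hα1.add hβ1, fun y hy => ?_⟩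
  have hn := e.open_target.mem_nhds hy
  rw [extDeriv_add ((hα1.differentiableOn (by simp)).differentiableAt hn)
    ((hβ1.differentiableOn (by simp)).differentiableAt hn), hα2 y hy, hβ2 y hy, add_zero]

theorem FormField.IsClosedForm.smul {α : FormField E M a} (hα : α.IsClosedForm) (c : ℝ) :
    (c • α).IsClosedForm := by
  intro e he
  have h : (c • α).inChart e = c • α.inChart e := rfl
  obtain ⟨hα1, hα2⟩ := hα e he
  rw [h]
  refine ⟨hα1.const_smul c, fun y hy => ?_⟩
  rw [extDeriv_smul, hα2 y hy, smul_zero]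

theorem FormField.IsClosedForm.wedgePow {α : FormField E M a} (hα : α.IsClosedForm) (ha : Even a)
    (p : ℕ) : (α.wedgePow p).IsClosedForm := by
  induction p with
  | zero =>
    intro e he
    have h : (α.wedgePow 0).inChart e = fun _ =>
      (haveI : IsEmpty (Fin (a * 0)) := inferInstanceAs (IsEmpty (Fin 0))
      ContinuousAlternatingMap.constOfIsEmpty ℝ E (Fin (a * 0)) (1 : ℝ)) := rfl
    rw [h]
    refine ⟨contDiffOn_const, fun y _ => ?_⟩
    ext v
    simp [extDeriv, ContinuousAlternatingMap.alternatizeUncurryFin_apply]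
  | succ p ih => exact FormField.IsClosedForm.wedge (α := α.wedgePow p) ih hα (ha.mul_right p)

end Closed

/-! ### Comass and faces on an inner product space -/

section Comass

variable {V : Type*} [AddCommGroup V] [Module ℝ V] [TopologicalSpace V]

/-- The condition 0 ≤ C covers the case without admissible tuples, where the supremum of the empty
set is 0 by convention. -/
theorem comass_le {g : V →L[ℝ] V →L[ℝ] ℝ} {k : ℕ} {η : V [⋀^Fin k]→L[ℝ] ℝ} {C : ℝ} (hC : 0 ≤ C)
    (hg : ∀ v, v ≠ 0 → 0 < length g v) (h : ∀ v, η v ≤ C * ∏ i, length g (v i)) :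
    comass g η ≤ C := by
  refine Real.sSup_le ?_ hC
  rintro r ⟨v, hv, rfl⟩
  exact (div_le_iff₀ (Finset.prod_pos fun i _ => hg _ (hv i))).mpr (h v)

theorem comass_eq {g : V →L[ℝ] V →L[ℝ] ℝ} {k : ℕ} {η : V [⋀^Fin k]→L[ℝ] ℝ}
    (hg : ∀ v, v ≠ 0 → 0 < length g v) (h : ∀ v, η v ≤ 1 * ∏ i, length g (v i)) {e : Fin k → V}
    (he : ∀ i, length g (e i) = 1) (hη : η e = 1) : comass g η = 1 := by
  refine le_antisymm (comass_le zero_le_one hg h) (le_csSup ⟨1, ?_⟩ ⟨e, fun i hi => ?_, ?_⟩)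
  · rintro r ⟨v, hv, rfl⟩
    exact (div_le_iff₀ (Finset.prod_pos fun i _ => hg _ (hv i))).mpr (h v)
  · have := he i
    rw [hi, length, map_zero, Real.sqrt_zero] at this
    exact zero_ne_one this
  · simp [he, hη]

end Comass

section InnerProduct

variable {F : Type*} [NormedAddCommGroup F] [InnerProductSpace ℝ F]
variable {I J K : F →ₗ[ℝ] F} {p : ℕ} {g : F →L[ℝ] F →L[ℝ] ℝ}

/-- A form of degree `4p` which on orthonormal families is at most `1`, with equality only on
quaternionic subspaces, and which does take the value `1` on a basis of each of these, is normalized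
with exactly these subspaces as faces. -/
theorem comass_and_faces [FiniteDimensional ℝ F] (h : IsHyperhermitian I J K)
    (hg : ∀ v w, g v w = inner ℝ v w)
    (η : F [⋀^Fin (4 * p)]→L[ℝ] ℝ)
    (hle : ∀ e, Orthonormal ℝ e → |η e| ≤ 1)
    (hinv : ∀ e, Orthonormal ℝ e → η e = 1 → ∀ v ∈ Submodule.span ℝ (Set.range e),
      I v ∈ Submodule.span ℝ (Set.range e) ∧ J v ∈ Submodule.span ℝ (Set.range e) ∧
        K v ∈ Submodule.span ℝ (Set.range e))
    (hex : ∀ W : Submodule ℝ F, Module.finrank ℝ W = 4 * p → (∀ v ∈ W, I v ∈ W) →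
      (∀ v ∈ W, J v ∈ W) → (∀ v ∈ W, K v ∈ W) → ∃ e : Fin (4 * p) → F, Orthonormal ℝ e ∧
        Submodule.span ℝ (Set.range e) = W ∧ η e = 1) :
    comass g η ≤ 1 ∧
    (∀ W : Submodule ℝ F, IsFace g η W ↔ (∀ v ∈ W, I v ∈ W) ∧ (∀ v ∈ W, J v ∈ W) ∧
      (∀ v ∈ W, K v ∈ W) ∧ Module.finrank ℝ W = 4 * p) ∧
    (4 * p ≤ Module.finrank ℝ F → comass g η = 1) := by
  have hlen : ∀ v, length g v = ‖v‖ := fun v => by rw [length, hg, ← norm_eq_sqrt_real_inner]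
  have hpos : ∀ v, v ≠ 0 → 0 < length g v := fun v hv => by rw [hlen]; exact norm_pos_iff.mpr hv
  have hbound : ∀ v, η v ≤ 1 * ∏ i, length g (v i) := fun v => by
    simp only [hlen]
    exact (le_abs_self _).trans (abs_apply_le_prod_norm η.toAlternatingMap zero_le_one hle v)
  have hcomass : 4 * p ≤ Module.finrank ℝ F → comass g η = 1 := by
    intro hp
    obtain ⟨W, hI, hJ, hK, hW⟩ := h.exists_quaternionic_subspace p hp
    obtain ⟨e, he, -, he1⟩ := hex W hW hI hJ hK
    exact comass_eq hpos hbound (fun i => (hlen _).trans (he.1 i)) he1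
  refine ⟨comass_le zero_le_one hpos hbound, fun W => ⟨?_, ?_⟩, hcomass⟩
  · rintro ⟨e, he, rfl, hη⟩
    have he' : Orthonormal ℝ e := by
      rw [orthonormal_iff_ite]
      intro i j
      rw [← hg, he]
    have hfin : Module.finrank ℝ (Submodule.span ℝ (Set.range e)) = 4 * p := by
      rw [finrank_span_eq_card he'.linearIndependent, Fintype.card_fin]
    -- The face itself is a 4p-dimensional subspace, so 4p ≤ dim F and the comass attained on it is
    -- exactly 1.
    have h1 := hinv e he' (hη.trans (hcomass (hfin ▸ Submodule.finrank_le _)))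
    exact ⟨fun v hv => (h1 v hv).1, fun v hv => (h1 v hv).2.1, fun v hv => (h1 v hv).2.2, hfin⟩
  · rintro ⟨hI, hJ, hK, hW⟩
    obtain ⟨e, he, hs, he1⟩ := hex W hW hI hJ hK
    refine ⟨e, fun i j => ?_, hs, he1.trans (hcomass (hW ▸ Submodule.finrank_le _)).symm⟩
    rw [hg, orthonormal_iff_ite.mp he]

variable {ωI ωJ ωK : F [⋀^Fin 2]→L[ℝ] ℝ}

theorem toExt_eq_omega {A : F →ₗ[ℝ] F} {τ : F [⋀^Fin 2]→L[ℝ] ℝ}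
    (hτ : ∀ v w, τ ![v, w] = inner ℝ (A v) w) {n : ℕ} (e : Fin n → F) :
    toExt e (Pi.basisFun ℝ (Fin n)) τ.toAlternatingMap = (omega A e).1 := by
  rw [toExt_two]
  simp only [omega]
  congr 1
  ext i j
  exact hτ _ _

theorem toExt_wedge_self {A : F →ₗ[ℝ] F} {τ : F [⋀^Fin 2]→L[ℝ] ℝ}
    (hτ : ∀ v w, τ ![v, w] = inner ℝ (A v) w) {n : ℕ} (e : Fin n → F) :
    toExt e (Pi.basisFun ℝ (Fin n)) (wedge τ τ).toAlternatingMap = (omega A e ^ 2).1 := by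
  rw [SubmonoidClass.coe_pow, sq, ← toExt_eq_omega hτ]
  exact toExt_wedgeAlt _ _ _ _

theorem wedgePow_add_add_apply (hI : ∀ v w, ωI ![v, w] = inner ℝ (I v) w)
    (hJ : ∀ v w, ωJ ![v, w] = inner ℝ (J v) w) (hK : ∀ v w, ωK ![v, w] = inner ℝ (K v) w)
    (e : Fin (4 * p) → F) :
    wedgePow (wedge ωI ωI + wedge ωJ ωJ + wedge ωK ωK : F [⋀^Fin 4]→L[ℝ] ℝ) p e =
      topCenter _ ((omega I e ^ 2 + omega J e ^ 2 + omega K e ^ 2) ^ p) := by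
  have h1 := topCoeff_toExt e (wedgePow (wedge ωI ωI + wedge ωJ ωJ + wedge ωK ωK :
    F [⋀^Fin 4]→L[ℝ] ℝ) p).toAlternatingMap
  refine h1.symm.trans ?_
  have h2 : (wedge ωI ωI + wedge ωJ ωJ + wedge ωK ωK : F [⋀^Fin 4]→L[ℝ] ℝ).toAlternatingMap =
    (wedge ωI ωI).toAlternatingMap + (wedge ωJ ωJ).toAlternatingMap +
      (wedge ωK ωK).toAlternatingMap := rfl
  rw [toExt_wedgePow, h2, toExt_add, toExt_add, toExt_wedge_self hI, toExt_wedge_self hJ,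
    toExt_wedge_self hK]
  rfl

theorem wedgePow_add_apply (hJ : ∀ v w, ωJ ![v, w] = inner ℝ (J v) w)
    (hK : ∀ v w, ωK ![v, w] = inner ℝ (K v) w) (e : Fin (4 * p) → F) :
    wedgePow (wedge ωJ ωJ + wedge ωK ωK : F [⋀^Fin 4]→L[ℝ] ℝ) p e =
      topCenter _ ((omega J e ^ 2 + omega K e ^ 2) ^ p) := by
  have h1 := topCoeff_toExt e (wedgePow (wedge ωJ ωJ + wedge ωK ωK :
    F [⋀^Fin 4]→L[ℝ] ℝ) p).toAlternatingMap
  refine h1.symm.trans ?_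
  have h2 : (wedge ωJ ωJ + wedge ωK ωK : F [⋀^Fin 4]→L[ℝ] ℝ).toAlternatingMap =
    (wedge ωJ ωJ).toAlternatingMap + (wedge ωK ωK).toAlternatingMap := rfl
  rw [toExt_wedgePow, h2, toExt_add, toExt_wedge_self hJ, toExt_wedge_self hK]
  rfl

theorem inv_mul_eq_one_iff_of_pos {a c : ℝ} (hc : 0 < c) : c⁻¹ * a = 1 ↔ a = c := by
  rw [inv_mul_eq_iff_eq_mul₀ hc.ne', mul_one]

theorem abs_inv_mul_le_one {a c : ℝ} (hc : 0 < c) (h : |a| ≤ c) : |c⁻¹ * a| ≤ 1 := by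
  rw [abs_mul, abs_of_pos (inv_pos.mpr hc)]
  exact inv_mul_le_one_of_le₀ h hc.le

theorem theta_comass_and_faces [FiniteDimensional ℝ F] (h : IsHyperhermitian I J K)
    (hg : ∀ v w, g v w = inner ℝ v w)
    (hI : ∀ v w, ωI ![v, w] = inner ℝ (I v) w)
    (hJ : ∀ v w, ωJ ![v, w] = inner ℝ (J v) w) (hK : ∀ v w, ωK ![v, w] = inner ℝ (K v) w)
    {η : F [⋀^Fin (4 * p)]→L[ℝ] ℝ} (hη : η = (HyperkahlerStructure.c p)⁻¹ •
      wedgePow (wedge ωI ωI + wedge ωJ ωJ + wedge ωK ωK : F [⋀^Fin 4]→L[ℝ] ℝ) p) :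
    comass g η ≤ 1 ∧
    (∀ W : Submodule ℝ F, IsFace g η W ↔ (∀ v ∈ W, I v ∈ W) ∧ (∀ v ∈ W, J v ∈ W) ∧
      (∀ v ∈ W, K v ∈ W) ∧ Module.finrank ℝ W = 4 * p) ∧
    (4 * p ≤ Module.finrank ℝ F → comass g η = 1) := by
  have hv : ∀ e, η e = ((2 * p + 1).factorial : ℝ)⁻¹ *
      topCenter _ ((omega I e ^ 2 + omega J e ^ 2 + omega K e ^ 2) ^ p) := fun e => by
    rw [hη, ← wedgePow_add_add_apply hI hJ hK, HyperkahlerStructure.c_eq]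
    rfl
  have hc : (0 : ℝ) < (2 * p + 1).factorial := by positivity
  refine comass_and_faces h hg η (fun e he => ?_) (fun e he h1 => ?_) fun W hW h1 h2 h3 => ?_
  · rw [hv]
    exact abs_inv_mul_le_one hc (h.abs_theta_le he)
  · rw [hv, inv_mul_eq_one_iff_of_pos hc] at h1
    exact h.invariant_of_theta_eq he h1
  · obtain ⟨e, he, hs, ht, -⟩ := h.exists_orthonormal_eq hW h1 h2 h3
    exact ⟨e, he, hs, by rw [hv, ht, inv_mul_cancel₀ hc.ne']⟩

theorem xi_comass_and_faces [FiniteDimensional ℝ F] (h : IsHyperhermitian I J K)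
    (hg : ∀ v w, g v w = inner ℝ v w)
    (hJ : ∀ v w, ωJ ![v, w] = inner ℝ (J v) w) (hK : ∀ v w, ωK ![v, w] = inner ℝ (K v) w)
    {η : F [⋀^Fin (4 * p)]→L[ℝ] ℝ} (hη : η = ((p.factorial : ℝ) ^ 2 * 4 ^ p)⁻¹ •
      wedgePow (wedge ωJ ωJ + wedge ωK ωK : F [⋀^Fin 4]→L[ℝ] ℝ) p) :
    comass g η ≤ 1 ∧
    (∀ W : Submodule ℝ F, IsFace g η W ↔ (∀ v ∈ W, I v ∈ W) ∧ (∀ v ∈ W, J v ∈ W) ∧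
      (∀ v ∈ W, K v ∈ W) ∧ Module.finrank ℝ W = 4 * p) ∧
    (4 * p ≤ Module.finrank ℝ F → comass g η = 1) := by
  have hv : ∀ e, η e = ((p.factorial : ℝ) ^ 2 * 4 ^ p)⁻¹ *
      topCenter _ ((omega J e ^ 2 + omega K e ^ 2) ^ p) := fun e => by
    rw [hη, ← wedgePow_add_apply hJ hK]
    rfl
  have hc : (0 : ℝ) < (p.factorial : ℝ) ^ 2 * 4 ^ p := by positivity
  refine comass_and_faces h hg η (fun e he => ?_) (fun e he h1 => ?_) fun W hW h1 h2 h3 => ?_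
  · rw [hv]
    exact abs_inv_mul_le_one hc (h.abs_xi_le he)
  · rw [hv, inv_mul_eq_one_iff_of_pos hc] at h1
    exact h.invariant_of_xi_eq he h1
  · obtain ⟨e, he, hs, -, ht⟩ := h.exists_orthonormal_eq hW h1 h2 h3
    exact ⟨e, he, hs, by rw [hv, ht, inv_mul_cancel₀ hc.ne']⟩

end InnerProduct

/-! ### Application to the tangent spaces -/

section Manifold

variable {E : Type*} [NormedAddCommGroup E] [NormedSpace ℝ E]
variable {M : Type*} [TopologicalSpace M] [ChartedSpace E M]

theorem FormField.IsClosedForm.square {α : FormField E M 2} (h : α.IsClosedForm) :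
    α.square.IsClosedForm :=
  FormField.IsClosedForm.wedge h h even_two

variable [IsManifold 𝓘(ℝ, E) ∞ M]

namespace HyperkahlerStructure

variable (S : HyperkahlerStructure E M)

open scoped Bundle in
/-- Comass and faces of both forms on a tangent space. -/
theorem pointwise [FiniteDimensional ℝ E] (p : ℕ) (x : M) :
    (comass (S.g.inner x) (S.Θ p x) ≤ 1 ∧
      (∀ W, IsFace (S.g.inner x) (S.Θ p x) W ↔ S.IsQuaternionicSubspace p x W) ∧
      (4 * p ≤ Module.finrank ℝ E → comass (S.g.inner x) (S.Θ p x) = 1)) ∧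
    (comass (S.g.inner x) (S.Ξ p x) ≤ 1 ∧
      (∀ W, IsFace (S.g.inner x) (S.Ξ p x) W ↔ S.IsQuaternionicSubspace p x W) ∧
      (4 * p ≤ Module.finrank ℝ E → comass (S.g.inner x) (S.Ξ p x) = 1)) := by
  -- Equips the tangent space with the inner product of the metric, so that the linear algebra above
  -- applies and agrees with `S.g` by definition.
  let B : Bundle.RiemannianBundle (fun x : M => TangentSpace 𝓘(ℝ, E) x) :=
    ⟨S.g.toRiemannianMetric⟩
  have : FiniteDimensional ℝ (TangentSpace 𝓘(ℝ, E) x) := inferInstanceAs (FiniteDimensional ℝ E)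
  have hg : ∀ v w : TangentSpace 𝓘(ℝ, E) x, S.g.inner x v w = inner ℝ v w := fun _ _ => rfl
  have h : IsHyperhermitian (S.I.toFun x).toLinearMap (S.J.toFun x).toLinearMap
      (S.K.toFun x).toLinearMap :=
    { I_I := S.I.sq x
      J_J := S.J.sq x
      I_J := S.I_J x
      J_I := S.J_I x
      inner_I := S.kahler_I.hermitian x
      inner_J := S.kahler_J.hermitian x }
  exact ⟨theta_comass_and_faces (ωI := S.omegaI x) (ωJ := S.omegaJ x) (ωK := S.omegaK x) h hg
      (fun _ _ => rfl) (fun _ _ => rfl) (fun _ _ => rfl) rfl,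
    xi_comass_and_faces (ωJ := S.omegaJ x) (ωK := S.omegaK x) h hg
      (fun _ _ => rfl) (fun _ _ => rfl) rfl⟩

theorem isClosedForm_Θ (p : ℕ) : (S.Θ p).IsClosedForm :=
  FormField.IsClosedForm.smul (FormField.IsClosedForm.wedgePow
    (((S.kahler_I.closed.square).add (S.kahler_J.closed.square)).add
      (S.kahler_K.closed.square)) (by decide) p) _

theorem isClosedForm_Ξ (p : ℕ) : (S.Ξ p).IsClosedForm :=
  FormField.IsClosedForm.smul (FormField.IsClosedForm.wedgePow
    ((S.kahler_J.closed.square).add (S.kahler_K.closed.square))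
      (by decide) p) _

end HyperkahlerStructure

end Manifold

end Calibration

theorem mainTheorem1
    {E : Type*} [NormedAddCommGroup E] [NormedSpace ℝ E] [FiniteDimensional ℝ E]
    {M : Type*} [TopologicalSpace M] [ChartedSpace E M] [IsManifold 𝓘(ℝ, E) ∞ M]
    (S : Calibration.HyperkahlerStructure E M) (p : ℕ) :
    (Calibration.IsCalibration S.g (S.Θ p) ∧
      ∀ (x : M) (W : Submodule ℝ (TangentSpace 𝓘(ℝ, E) x)),
        Calibration.IsFace (S.g.inner x) (S.Θ p x) W ↔ S.IsQuaternionicSubspace p x W) ∧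
    (Calibration.IsCalibration S.g (S.Ξ p) ∧
      ∀ (x : M) (W : Submodule ℝ (TangentSpace 𝓘(ℝ, E) x)),
        Calibration.IsFace (S.g.inner x) (S.Ξ p x) W ↔ S.IsQuaternionicSubspace p x W) ∧
    (4 * p ≤ Module.finrank ℝ E → ∀ x : M,
      Calibration.comass (S.g.inner x) (S.Θ p x) = 1 ∧
        Calibration.comass (S.g.inner x) (S.Ξ p x) = 1) :=
  ⟨⟨⟨S.isClosedForm_Θ p, fun x => (S.pointwise p x).1.1⟩, fun x => (S.pointwise p x).1.2.1⟩,
    ⟨⟨S.isClosedForm_Ξ p, fun x => (S.pointwise p x).2.1⟩, fun x => (S.pointwise p x).2.2.1⟩,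
    fun hp x => ⟨(S.pointwise p x).1.2.2 hp, (S.pointwise p x).2.2.2 hp⟩⟩
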